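/- Let $\Bbbk$ be a field of characteristic $0$ with a Hausdorff ring topology (for instance the discrete topology, or the usual topology if $\Bbbk=\mathbb R$ or $\mathbb C$). For $n\ge 0$ let $\mathcal W_n$ be the Lie algebra of formal vector fields $\sum_{i=1}^n f_i\partial_i$ with $f_i\in\Bbbk[[x_1,\dots,x_n]]$, with the commutator bracket $[X,Y]_j=\sum_i (X_i\,\partial_i Y_j-Y_i\,\partial_i X_j)$. For $d\ge 0$ let $\mathsf L_d(n)=\prod_{k\ge d}S^kV\otimes V^*\subset\mathcal W_n$, where $V=\langle x_1,\dots,x_n\rangle$, be the Lie subalgebra of those vector fields all of whose coefficients $f_i$ have no monomials of total degree less than $d$ (so $\mathsf L_0(n)=\mathcal W_n$). Equip $\mathcal W_n$ with the translation-invariant topology in which the subalgebras $\mathsf L_m(n)$, $m\ge 0$, form a basis of neighbourhoods of $0$, and $\mathsf L_d(n)$ with the subspace topology. Let $C_c^k(\mathsf L_d(n);\Bbbk)$ be the space of continuous alternating $k$-multilinear maps $\mathsf L_d(n)^k\to\Bbbk$, with the Chevalley–Eilenberg differential $$(dc)(v_0,\dots,v_k)=\sum_{0\le i<j\le k}(-1)^{i+j}c([v_i,v_j],v_0,\dots,\widehat{v_i},\dots,\widehat{v_j},\dots,v_k),$$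 and let $H_c^k(\mathsf L_d(n);\Bbbk)$ be the $k$-th cohomology of this complex, the continuous cohomology with trivial coefficients. Then for all integers $k,n,d\ge 0$ the $\Bbbk$-vector space $H_c^k(\mathsf L_d(n);\Bbbk)$ is finite-dimensional. -/

import Mathlib

open scoped Topology

/-! ### The Chevalley–Eilenberg complex with trivial coefficients -/

namespace LieCohomology

section Algebraic

variable {R L : Type*} [CommRing R] [LieRing L] [LieAlgebra R L]

/-- The Chevalley–Eilenberg differential of an alternating form `c` of degree `k`
(trivial coefficients), as a function of `k + 1` vectors:
`(dc)(v₀, …, v_k) = ∑_{i < j} (-1)^j c(v₀, …, ⁅v_i, v_j⁆, …, v̂_j, …, v_k)`,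
where `⁅v_i, v_j⁆` stands in the `i`-th place and `v_j` is omitted.  Moving the bracket to the
front gives the sign `(-1)^(i + j)`, see `ceFun_eq_front`. -/
def ceFun {k : ℕ} (c : L [⋀^Fin k]→ₗ[R] R) (v : Fin (k + 1) → L) : R :=
  ∑ j : Fin (k + 1), (-1) ^ (j : ℕ) * ∑ i : Fin k,
    if i.castSucc < j then c (Function.update (j.removeNth v) i ⁅v i.castSucc, v j⁆) else 0

/-- The textbook form of the differential:
`(dc)(v₀, …, v_k) = ∑_{i < j} (-1)^(i + j) c(⁅v_i, v_j⁆, v₀, …, v̂_i, …, v̂_j, …, v_k)`. -/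
theorem ceFun_eq_front {k : ℕ} (c : L [⋀^Fin (k + 1)]→ₗ[R] R) (v : Fin (k + 2) → L) :
    ceFun c v = ∑ j : Fin (k + 2), ∑ i : Fin (k + 1),
      if i.castSucc < j then
        (-1) ^ ((i : ℕ) + (j : ℕ)) *
          c (Matrix.vecCons ⁅v i.castSucc, v j⁆ (i.removeNth (j.removeNth v)))
      else 0 := by
  unfold ceFun
  refine Finset.sum_congr rfl fun j _ => ?_
  rw [Finset.mul_sum]
  refine Finset.sum_congr rfl fun i _ => ?_
  split_ifs
  · rw [← Fin.insertNth_removeNth, AlternatingMap.map_insertNth]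
    simp only [zsmul_eq_mul, Int.cast_pow, Int.cast_neg, Int.cast_one]
    ring
  · simp

/-- The Lie derivative of an alternating form, as a multilinear map. -/
def lieDerMultilinear {k : ℕ} (x : L) (c : L [⋀^Fin k]→ₗ[R] R) :
    MultilinearMap R (fun _ : Fin k => L) R :=
  -∑ i : Fin k, c.toMultilinearMap.compLinearMap
    (Function.update (fun _ => LinearMap.id) i (LieAlgebra.ad R L x : L →ₗ[R] L))

theorem lieDerMultilinear_apply {k : ℕ} (x : L) (c : L [⋀^Fin k]→ₗ[R] R) (w : Fin k → L) :
    lieDerMultilinear x c w = -∑ i, c (Function.update w i ⁅x, w i⁆) := by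
  simp only [lieDerMultilinear, neg_apply, sum_apply,
    MultilinearMap.compLinearMap_apply, AlternatingMap.coe_multilinearMap]
  congr 1
  refine Finset.sum_congr rfl fun i _ => congrArg c ?_
  ext l
  by_cases h : l = i
  · subst h
    simp
  · simp [Function.update_of_ne h]

/-- The Lie derivative `(𝓛_x c)(w) = -∑ i, c(w₁, …, ⁅x, w_i⁆, …, w_k)` of an alternating form. -/
def lieDer {k : ℕ} (x : L) (c : L [⋀^Fin k]→ₗ[R] R) : L [⋀^Fin k]→ₗ[R] R where
  toMultilinearMap := lieDerMultilinear x c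
  map_eq_zero_of_eq' := by
    intro w a b hab hne
    change lieDerMultilinear x c w = 0
    rw [lieDerMultilinear_apply, neg_eq_zero, Finset.sum_eq_add a b hne]
    · have h : Function.update w b ⁅x, w b⁆
          = Function.update w a ⁅x, w a⁆ ∘ Equiv.swap a b := by
        ext l
        by_cases h1 : l = a
        · subst h1
          simp [Function.update_of_ne hne, Function.update_of_ne hne.symm, hab]
        · by_cases h2 : l = b
          · subst h2
            simp [hab]
          · simp [Equiv.swap_apply_of_ne_of_ne h1 h2, Function.update_of_ne h1,
              Function.update_of_ne h2]
      rw [h, AlternatingMap.map_swap c _ hne, add_neg_cancel]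
    · intro l _ hl
      exact c.map_eq_zero_of_eq _ (by
        rw [Function.update_of_ne hl.1.symm, Function.update_of_ne hl.2.symm, hab]) hne
    · simp
    · simp

theorem lieDer_apply {k : ℕ} (x : L) (c : L [⋀^Fin k]→ₗ[R] R) (w : Fin k → L) :
    lieDer x c w = -∑ i, c (Function.update w i ⁅x, w i⁆) :=
  lieDerMultilinear_apply x c w

theorem lieDer_zero {k : ℕ} (x : L) : lieDer x (0 : L [⋀^Fin k]→ₗ[R] R) = 0 := by
  ext w
  simp [lieDer_apply]

theorem lieDer_sub {k : ℕ} (x : L) (c c' : L [⋀^Fin k]→ₗ[R] R) :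
    lieDer x (c - c') = lieDer x c - lieDer x c' := by
  ext w
  simp [lieDer_apply]
  abel

theorem curryLeft_lieDer {k : ℕ} (x z : L) (c : L [⋀^Fin (k + 1)]→ₗ[R] R) :
    (lieDer x c).curryLeft z = lieDer x (c.curryLeft z) - c.curryLeft ⁅x, z⁆ := by
  ext w
  simp only [AlternatingMap.curryLeft_apply_apply, AlternatingMap.sub_apply, lieDer_apply,
    Fin.sum_univ_succ, Matrix.vecCons, Fin.cons_zero, Fin.cons_succ, Fin.update_cons_zero,
    Fin.cons_update]
  abel

theorem ext_curryLeft {k : ℕ} {c c' : L [⋀^Fin (k + 1)]→ₗ[R] R}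
    (h : ∀ x, c.curryLeft x = c'.curryLeft x) : c = c' := by
  ext v
  have := congrArg (fun f => f (Matrix.vecTail v)) (h (Matrix.vecHead v))
  simpa using this

theorem ceFun_zero_degree (c : L [⋀^Fin 0]→ₗ[R] R) (v : Fin 1 → L) : ceFun c v = 0 := by
  simp [ceFun]

theorem ceFun_vecCons {k : ℕ} (c : L [⋀^Fin (k + 1)]→ₗ[R] R) (x : L) (w : Fin (k + 1) → L) :
    ceFun c (Matrix.vecCons x w) = lieDer x c w - ceFun (c.curryLeft x) w := by
  have key : ∀ j : Fin (k + 1), ∀ y : L,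
      (-1 : R) ^ (j : ℕ) * c (Matrix.vecCons y (j.removeNth w)) = c (Function.update w j y) := by
    intro j y
    rw [← AlternatingMap.neg_one_pow_smul_map_insertNth c j y, Fin.insertNth_removeNth]
    simp only [zsmul_eq_mul, Int.cast_pow, Int.cast_neg, Int.cast_one]
    rw [← mul_assoc, ← pow_add, Even.neg_one_pow ⟨_, rfl⟩, one_mul]
  have hrem : ∀ j : Fin (k + 1), (j.succ).removeNth (Matrix.vecCons x w : Fin (k + 2) → L)
      = Matrix.vecCons x (j.removeNth w) := by
    intro j
    ext l
    refine Fin.cases ?_ (fun l => ?_) l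
    · simp [Fin.removeNth]
    · simp [Fin.removeNth]
  unfold ceFun
  rw [Fin.sum_univ_succ, lieDer_apply]
  simp only [Fin.not_lt_zero, if_false, Finset.sum_const_zero, mul_zero, zero_add, hrem]
  rw [← Finset.sum_neg_distrib, ← Finset.sum_sub_distrib]
  refine Finset.sum_congr rfl fun j _ => ?_
  rw [Fin.sum_univ_succ, ← key]
  simp only [Fin.castSucc_zero, Fin.succ_pos, if_true, Matrix.cons_val_zero, Matrix.cons_val_succ,
    ← Fin.succ_castSucc, Fin.succ_lt_succ_iff, AlternatingMap.curryLeft_apply_apply,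
    Fin.val_succ, pow_succ]
  simp only [Matrix.vecCons, Fin.update_cons_zero, Fin.cons_update]
  ring

theorem ceFun_add {k : ℕ} (c c' : L [⋀^Fin k]→ₗ[R] R) (v : Fin (k + 1) → L) :
    ceFun (c + c') v = ceFun c v + ceFun c' v := by
  unfold ceFun
  rw [← Finset.sum_add_distrib]
  refine Finset.sum_congr rfl fun j _ => ?_
  rw [← mul_add, ← Finset.sum_add_distrib]
  refine congrArg (fun t => (-1) ^ (j : ℕ) * t) (Finset.sum_congr rfl fun i _ => ?_)
  split_ifs <;> simp

theorem ceFun_smul {k : ℕ} (r : R) (c : L [⋀^Fin k]→ₗ[R] R) (v : Fin (k + 1) → L) :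
    ceFun (r • c) v = r * ceFun c v := by
  unfold ceFun
  simp only [Finset.mul_sum]
  refine Finset.sum_congr rfl fun j _ => Finset.sum_congr rfl fun i _ => ?_
  split_ifs
  · rw [AlternatingMap.smul_apply, smul_eq_mul, mul_left_comm]
  · simp

theorem ceFun_vecCons_self {k : ℕ} (c : L [⋀^Fin (k + 1)]→ₗ[R] R) (x : L)
    (w : Fin (k + 1) → L) (hw : w 0 = x) : ceFun c (Matrix.vecCons x w) = 0 := by
  rw [ceFun_vecCons]
  cases k with
  | zero =>
    rw [ceFun_zero_degree, sub_zero, lieDer_apply]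
    simp [hw]
  | succ k =>
    obtain ⟨u, rfl⟩ : ∃ u, w = Matrix.vecCons x u :=
      ⟨Matrix.vecTail w, by rw [← hw]; exact (Matrix.cons_head_tail w).symm⟩
    rw [ceFun_vecCons, AlternatingMap.curryLeft_same, ← AlternatingMap.curryLeft_apply_apply,
      curryLeft_lieDer]
    have h0 : ceFun (0 : L [⋀^Fin k]→ₗ[R] R) u = 0 := by simp [ceFun]
    rw [h0]
    simp

theorem exists_ce : ∀ {k : ℕ} (c : L [⋀^Fin k]→ₗ[R] R),
    ∃ D : L [⋀^Fin (k + 1)]→ₗ[R] R, ∀ v, D v = ceFun c v := by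
  intro k
  induction k with
  | zero => exact fun c => ⟨0, fun v => by simp [ceFun_zero_degree]⟩
  | succ k ih =>
    intro c
    choose D hD using fun x => ih (c.curryLeft x)
    let E : L → L [⋀^Fin (k + 1)]→ₗ[R] R := fun x => lieDer x c - D x
    have hE : ∀ x w, ceFun c (Matrix.vecCons x w) = E x w := fun x w => by
      rw [ceFun_vecCons, AlternatingMap.sub_apply, hD]
    have hv : ∀ v : Fin (k + 2) → L, ∃ x w, v = Matrix.vecCons x w := fun v =>
      ⟨_, _, (Matrix.cons_head_tail v).symm⟩
    have hadd : ∀ x y w, E (x + y) w = E x w + E y w := by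
      intro x y w
      simp only [E, AlternatingMap.sub_apply, hD, lieDer_apply, map_add, ceFun_add, add_lie, AlternatingMap.map_update_add,
        Finset.sum_add_distrib]
      ring
    have hsmul : ∀ (r : R) x w, E (r • x) w = r * E x w := by
      intro r x w
      simp only [E, AlternatingMap.sub_apply, hD, lieDer_apply, map_smul, ceFun_smul, smul_lie,
        AlternatingMap.map_update_smul, smul_eq_mul, ← Finset.mul_sum]
      ring
    have hself : ∀ x w b, w b = x → E x w = 0 := by
      intro x w b hb
      by_cases h : b = 0
      · rw [← hE]
        exact ceFun_vecCons_self c x w (h ▸ hb)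
      · have h1 : E x (w ∘ Equiv.swap 0 b) = 0 := by
          rw [← hE]
          exact ceFun_vecCons_self c x _ (by simpa using hb)
        rwa [AlternatingMap.map_swap _ _ (Ne.symm h), neg_eq_zero] at h1
    refine ⟨⟨MultilinearMap.mk' (ceFun c) ?_ ?_, ?_⟩, fun v => rfl⟩
    · intro v l a b
      obtain ⟨x, w, rfl⟩ := hv v
      refine Fin.cases ?_ (fun l => ?_) l
      · simp only [Matrix.vecCons, Fin.update_cons_zero]
        exact (hE _ _).trans ((hadd a b w).trans (by rw [← hE, ← hE]; rfl))
      · simp only [Matrix.vecCons, ← Fin.cons_update]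
        exact (hE _ _).trans (((E x).map_update_add w l a b).trans (by rw [← hE, ← hE]; rfl))
    · intro v l r a
      obtain ⟨x, w, rfl⟩ := hv v
      refine Fin.cases ?_ (fun l => ?_) l
      · simp only [Matrix.vecCons, Fin.update_cons_zero]
        exact (hE _ _).trans ((hsmul r a w).trans (by rw [← hE]; rfl))
      · simp only [Matrix.vecCons, ← Fin.cons_update]
        exact (hE _ _).trans (((E x).map_update_smul w l r a).trans (by rw [← hE]; rfl))
    · intro v a b hab hne
      change ceFun c v = 0
      obtain ⟨x, w, rfl⟩ := hv v
      rw [hE]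
      induction a using Fin.cases with
      | zero =>
        induction b using Fin.cases with
        | zero => exact absurd rfl hne
        | succ b => exact hself x w b (by simpa using hab.symm)
      | succ a =>
        induction b using Fin.cases with
        | zero => exact hself x w a (by simpa using hab)
        | succ b =>
          exact (E x).map_eq_zero_of_eq w (by simpa using hab) (fun h => hne (by rw [h]))

/-- The Chevalley–Eilenberg differential on (algebraic) alternating forms. -/
noncomputable def ceAlg (R L : Type*) [CommRing R] [LieRing L] [LieAlgebra R L] (k : ℕ) :
    (L [⋀^Fin k]→ₗ[R] R) →ₗ[R] (L [⋀^Fin (k + 1)]→ₗ[R] R) where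
  toFun c :=
    { toFun := ceFun c
      map_update_add' := by
        intro _ v i x y
        obtain ⟨D, hD⟩ := exists_ce c
        simpa only [hD] using D.map_update_add v i x y
      map_update_smul' := by
        intro _ v i r x
        obtain ⟨D, hD⟩ := exists_ce c
        simpa only [hD] using D.map_update_smul v i r x
      map_eq_zero_of_eq' := by
        intro v i j h hne
        obtain ⟨D, hD⟩ := exists_ce c
        simpa only [hD] using D.map_eq_zero_of_eq v h hne }
  map_add' c c' := by
    ext v
    exact ceFun_add c c' v
  map_smul' r c := by
    ext v
    exact ceFun_smul r c v

theorem ceAlg_apply {k : ℕ} (c : L [⋀^Fin k]→ₗ[R] R) (v : Fin (k + 1) → L) :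
    ceAlg R L k c v = ceFun c v := rfl

theorem curryLeft_ceAlg {k : ℕ} (x : L) (c : L [⋀^Fin (k + 1)]→ₗ[R] R) :
    (ceAlg R L (k + 1) c).curryLeft x = lieDer x c - ceAlg R L k (c.curryLeft x) := by
  ext w
  exact ceFun_vecCons c x w

theorem lieDer_lie : ∀ {k : ℕ} (x y : L) (c : L [⋀^Fin k]→ₗ[R] R),
    lieDer x (lieDer y c) - lieDer y (lieDer x c) = lieDer ⁅x, y⁆ c := by
  intro k
  induction k with
  | zero => intro x y c; ext w; simp [lieDer_apply]
  | succ k ih =>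
    intro x y c
    refine ext_curryLeft fun z => ?_
    have h1 : (lieDer x (lieDer y c) - lieDer y (lieDer x c)).curryLeft z
        = (lieDer x (lieDer y c)).curryLeft z - (lieDer y (lieDer x c)).curryLeft z := by
      ext w; rfl
    rw [h1]
    simp only [curryLeft_lieDer, lieDer_sub]
    rw [← ih, lie_lie x y z, map_sub]
    abel

theorem lieDer_ceAlg : ∀ {k : ℕ} (x : L) (c : L [⋀^Fin k]→ₗ[R] R),
    lieDer x (ceAlg R L k c) = ceAlg R L k (lieDer x c) := by
  intro k
  induction k with
  | zero =>
    intro x c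
    ext w
    simp [lieDer_apply, ceAlg_apply, ceFun_zero_degree]
  | succ k ih =>
    intro x c
    refine ext_curryLeft fun z => ?_
    rw [curryLeft_lieDer, curryLeft_ceAlg, curryLeft_ceAlg, curryLeft_ceAlg, curryLeft_lieDer,
      lieDer_sub, map_sub, ih, ← lieDer_lie]
    abel

theorem ceAlg_ceAlg : ∀ {k : ℕ} (c : L [⋀^Fin k]→ₗ[R] R),
    ceAlg R L (k + 1) (ceAlg R L k c) = 0 := by
  intro k
  induction k with
  | zero =>
    intro c
    have : ceAlg R L 0 c = 0 := by ext v; exact ceFun_zero_degree c v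
    rw [this, map_zero]
  | succ k ih =>
    intro c
    refine ext_curryLeft fun z => ?_
    rw [curryLeft_ceAlg, curryLeft_ceAlg, map_sub, ih, lieDer_ceAlg, sub_zero, sub_self]
    rfl

end Algebraic

section Continuous

/-- The Lie bracket of a topological Lie algebra is (jointly) continuous. -/
class ContinuousLie (L : Type*) [TopologicalSpace L] [LieRing L] : Prop where
  continuous_lie : Continuous fun p : L × L => ⁅p.1, p.2⁆

variable (R L : Type*) [CommRing R] [TopologicalSpace R] [IsTopologicalRing R]
  [LieRing L] [LieAlgebra R L] [TopologicalSpace L] [ContinuousLie L]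

/-- The Chevalley–Eilenberg differential on continuous cochains `L × ⋯ × L → R`. -/
noncomputable def ceDiff (k : ℕ) : (L [⋀^Fin k]→L[R] R) →ₗ[R] (L [⋀^Fin (k + 1)]→L[R] R) where
  toFun c :=
    { ceAlg R L k c.toAlternatingMap with
      cont := by
        change Continuous fun v => ceFun c.toAlternatingMap v
        unfold ceFun
        refine continuous_finsetSum _ fun j _ => continuous_const.mul ?_
        refine continuous_finsetSum _ fun i _ => ?_
        split_ifs
        · refine c.cont.comp (Continuous.update ?_ i ?_)
          · exact continuous_pi fun l => continuous_apply (j.succAbove l)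
          · exact ContinuousLie.continuous_lie.comp
              ((continuous_apply i.castSucc).prodMk (continuous_apply j))
        · exact continuous_const }
  map_add' c c' := by
    ext v
    exact ceFun_add c.toAlternatingMap c'.toAlternatingMap v
  map_smul' r c := by
    ext v
    exact ceFun_smul r c.toAlternatingMap v

theorem ceDiff_comp_ceDiff (k : ℕ) : ceDiff R L (k + 1) ∘ₗ ceDiff R L k = 0 := by
  ext c v
  exact congrArg (fun f => f v) (ceAlg_ceAlg c.toAlternatingMap)

/-- Continuous `k`-cocycles with trivial coefficients. -/
noncomputable def cocycles (k : ℕ) : Submodule R (L [⋀^Fin k]→L[R] R) :=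
  LinearMap.ker (ceDiff R L k)

/-- Continuous `k`-coboundaries with trivial coefficients. -/
noncomputable def coboundaries : (k : ℕ) → Submodule R (L [⋀^Fin k]→L[R] R)
  | 0 => ⊥
  | k + 1 => LinearMap.range (ceDiff R L k)

theorem coboundaries_le_cocycles (k : ℕ) : coboundaries R L k ≤ cocycles R L k := by
  cases k with
  | zero => exact bot_le
  | succ k => exact LinearMap.range_le_ker_iff.2 (ceDiff_comp_ceDiff R L k)

/-- The quotient `Z / B` for submodules `B ⊆ Z` of a module. -/
abbrev Subquotient {R M : Type*} [Ring R] [AddCommGroup M] [Module R M] (Z B : Submodule R M) :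
    Type _ := Z ⧸ B.submoduleOf Z

/-- The continuous cohomology `H_c^k(L; R)` with trivial coefficients: the `k`-th cohomology of the
complex of continuous alternating multilinear forms on `L`. -/
abbrev ContinuousCohomology (k : ℕ) : Type _ :=
  Subquotient (cocycles R L k) (coboundaries R L k)

end Continuous

end LieCohomology

/-! ### Formal vector fields -/

/-- The space `W_n` of formal vector fields `∑ i, f_i ∂_i` in `n` variables, with
`f_i ∈ 𝕜⟦x₁, …, x_n⟧`; a vector field is given by its tuple of coefficients. -/
def FormalVectorField (𝕜 : Type*) (n : ℕ) : Type _ := Fin n → MvPowerSeries (Fin n) 𝕜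

namespace FormalVectorField

variable {𝕜 : Type*} [CommRing 𝕜] {n : ℕ}

noncomputable instance : AddCommGroup (FormalVectorField 𝕜 n) :=
  inferInstanceAs (AddCommGroup (Fin n → MvPowerSeries (Fin n) 𝕜))

noncomputable instance : Module 𝕜 (FormalVectorField 𝕜 n) :=
  inferInstanceAs (Module 𝕜 (Fin n → MvPowerSeries (Fin n) 𝕜))

@[ext] theorem ext {𝕜 : Type*} {n : ℕ} {X Y : FormalVectorField 𝕜 n} (h : ∀ j, X j = Y j) : X = Y := funext h

@[simp] theorem add_apply (X Y : FormalVectorField 𝕜 n) (j : Fin n) : (X + Y) j = X j + Y j := rfl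
@[simp] theorem sub_apply (X Y : FormalVectorField 𝕜 n) (j : Fin n) : (X - Y) j = X j - Y j := rfl
@[simp] theorem zero_apply (j : Fin n) : (0 : FormalVectorField 𝕜 n) j = 0 := rfl
@[simp] theorem smul_apply (r : 𝕜) (X : FormalVectorField 𝕜 n) (j : Fin n) :
    (r • X) j = r • X j := rfl

/-- The action `X(f) = ∑ i, X_i ∂_i f` of a formal vector field on a formal power series. -/
noncomputable def deriv (X : FormalVectorField 𝕜 n) :
    Derivation 𝕜 (MvPowerSeries (Fin n) 𝕜) (MvPowerSeries (Fin n) 𝕜) :=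
  ∑ i, X i • MvPowerSeries.pderiv 𝕜 i

/-- The commutator of formal vector fields: `⁅X, Y⁆_j = X(Y_j) - Y(X_j)`. -/
noncomputable instance : Bracket (FormalVectorField 𝕜 n) (FormalVectorField 𝕜 n) where
  bracket X Y := fun j => deriv X (Y j) - deriv Y (X j)

theorem deriv_apply (X : FormalVectorField 𝕜 n) (f : MvPowerSeries (Fin n) 𝕜) :
    deriv X f = ∑ i, X i * MvPowerSeries.pderiv 𝕜 i f := by
  have h := congrArg (fun F => F f)
    (map_sum (Derivation.coeFnAddMonoidHom (R := 𝕜) (A := MvPowerSeries (Fin n) 𝕜)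
      (M := MvPowerSeries (Fin n) 𝕜)) (fun i => X i • MvPowerSeries.pderiv 𝕜 i) Finset.univ)
  simp only [Finset.sum_apply] at h
  exact h

theorem lie_apply (X Y : FormalVectorField 𝕜 n) (j : Fin n) :
    ⁅X, Y⁆ j = deriv X (Y j) - deriv Y (X j) := rfl

theorem pderiv_comm (i j : Fin n) (f : MvPowerSeries (Fin n) 𝕜) :
    MvPowerSeries.pderiv 𝕜 i (MvPowerSeries.pderiv 𝕜 j f)
      = MvPowerSeries.pderiv 𝕜 j (MvPowerSeries.pderiv 𝕜 i f) := by
  by_cases h : i = j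
  · rw [h]
  · ext m
    simp only [MvPowerSeries.coeff_pderiv, Finsupp.add_apply, Finsupp.single_eq_of_ne h,
      Finsupp.single_eq_of_ne (Ne.symm h), add_zero]
    rw [add_right_comm]
    ring

theorem deriv_lie (X Y : FormalVectorField 𝕜 n) (f : MvPowerSeries (Fin n) 𝕜) :
    deriv ⁅X, Y⁆ f = deriv X (deriv Y f) - deriv Y (deriv X f) := by
  have key : ∀ X Y : FormalVectorField 𝕜 n, deriv X (deriv Y f)
      = (∑ i, ∑ j, Y i * X j * MvPowerSeries.pderiv 𝕜 j (MvPowerSeries.pderiv 𝕜 i f))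
        + ∑ i, deriv X (Y i) * MvPowerSeries.pderiv 𝕜 i f := by
    intro X Y
    rw [deriv_apply Y f, map_sum, ← Finset.sum_add_distrib]
    refine Finset.sum_congr rfl fun i _ => ?_
    rw [Derivation.leibniz, deriv_apply X (MvPowerSeries.pderiv 𝕜 i f), smul_eq_mul, smul_eq_mul,
      Finset.mul_sum, mul_comm (MvPowerSeries.pderiv 𝕜 i f)]
    simp only [mul_assoc]
  rw [key X Y, key Y X, Finset.sum_comm (f := fun i j =>
    X i * Y j * MvPowerSeries.pderiv 𝕜 j (MvPowerSeries.pderiv 𝕜 i f)), deriv_apply]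
  simp only [lie_apply, sub_mul, Finset.sum_sub_distrib]
  have h : ∀ i j, X j * Y i * MvPowerSeries.pderiv 𝕜 i (MvPowerSeries.pderiv 𝕜 j f)
      = Y i * X j * MvPowerSeries.pderiv 𝕜 j (MvPowerSeries.pderiv 𝕜 i f) := by
    intro i j
    rw [pderiv_comm, mul_comm (X j)]
  simp only [h]
  ring

theorem deriv_add (X Y : FormalVectorField 𝕜 n) (f : MvPowerSeries (Fin n) 𝕜) :
    deriv (X + Y) f = deriv X f + deriv Y f := by
  simp [deriv_apply, add_mul, Finset.sum_add_distrib]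

theorem deriv_smul (r : 𝕜) (X : FormalVectorField 𝕜 n) (f : MvPowerSeries (Fin n) 𝕜) :
    deriv (r • X) f = r • deriv X f := by
  simp [deriv_apply, Finset.smul_sum]

noncomputable instance : LieRing (FormalVectorField 𝕜 n) where
  add_lie X Y Z := by
    ext1 j
    simp only [lie_apply, add_apply, deriv_add, map_add]
    ring
  lie_add X Y Z := by
    ext1 j
    simp only [lie_apply, add_apply, deriv_add, map_add]
    ring
  lie_self X := by
    ext1 j
    simp [lie_apply]
  leibniz_lie X Y Z := by
    ext1 j
    simp only [lie_apply, add_apply, deriv_lie, map_sub]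
    ring

noncomputable instance : LieAlgebra 𝕜 (FormalVectorField 𝕜 n) where
  lie_smul r X Y := by
    ext1 j
    simp only [lie_apply, smul_apply, deriv_smul, Derivation.map_smul, smul_sub]

theorem coeff_mul_eq_zero {d : ℕ} (f g : MvPowerSeries (Fin n) 𝕜)
    (hf : ∀ m : Fin n →₀ ℕ, m.degree < d → MvPowerSeries.coeff m f = 0) (m : Fin n →₀ ℕ)
    (hm : m.degree < d) : MvPowerSeries.coeff m (f * g) = 0 := by
  classical
  rw [MvPowerSeries.coeff_mul]
  refine Finset.sum_eq_zero fun p hp => ?_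
  rw [Finset.HasAntidiagonal.mem_antidiagonal] at hp
  have : p.1.degree < d := lt_of_le_of_lt (by rw [← hp, map_add]; exact Nat.le_add_right _ _) hm
  rw [hf _ this, zero_mul]

theorem coeff_pderiv_eq_zero {d : ℕ} (f : MvPowerSeries (Fin n) 𝕜)
    (hf : ∀ m : Fin n →₀ ℕ, m.degree < d + 1 → MvPowerSeries.coeff m f = 0) (i : Fin n)
    (m : Fin n →₀ ℕ) (hm : m.degree < d) :
    MvPowerSeries.coeff m (MvPowerSeries.pderiv 𝕜 i f) = 0 := by
  rw [MvPowerSeries.coeff_pderiv, hf, zero_mul]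
  rw [map_add, Finsupp.degree_single]
  omega

variable (𝕜 n) in
/-- The Lie subalgebra `L_d(n) = ∏_{k ≥ d} S^k V ⊗ V^*` of `W_n`: the formal vector fields
`∑ i, f_i ∂_i` such that every `f_i` has no monomials of total degree less than `d`. -/
noncomputable def vanishing (d : ℕ) : LieSubalgebra 𝕜 (FormalVectorField 𝕜 n) where
  carrier := {X | ∀ (j : Fin n) (m : Fin n →₀ ℕ), m.degree < d → MvPowerSeries.coeff m (X j) = 0}
  add_mem' := by
    intro X Y hX hY j m hm
    rw [add_apply, map_add, hX j m hm, hY j m hm, add_zero]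
  zero_mem' := by
    intro j m _
    simp
  smul_mem' := by
    intro r X hX j m hm
    rw [smul_apply, map_smul, hX j m hm, smul_zero]
  lie_mem' := by
    intro X Y hX hY j m hm
    rw [lie_apply, map_sub, deriv_apply, deriv_apply, map_sum, map_sum]
    simp only [coeff_mul_eq_zero _ _ (hX _) m hm, coeff_mul_eq_zero _ _ (hY _) m hm,
      Finset.sum_const_zero, sub_zero]

theorem mem_vanishing {d : ℕ} {X : FormalVectorField 𝕜 n} : X ∈ vanishing 𝕜 n d ↔
    ∀ (j : Fin n) (m : Fin n →₀ ℕ), m.degree < d → MvPowerSeries.coeff m (X j) = 0 := Iff.rfl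

theorem vanishing_anti {d e : ℕ} (h : d ≤ e) : vanishing 𝕜 n e ≤ vanishing 𝕜 n d :=
  fun _ hX j m hm => hX j m (lt_of_lt_of_le hm h)

theorem lie_mem_vanishing {d : ℕ} (X : FormalVectorField 𝕜 n) {Y : FormalVectorField 𝕜 n}
    (hY : Y ∈ vanishing 𝕜 n (d + 1)) : ⁅X, Y⁆ ∈ vanishing 𝕜 n d := by
  intro j m hm
  rw [lie_apply, map_sub, deriv_apply, deriv_apply, map_sum, map_sum]
  have h1 : ∀ i, MvPowerSeries.coeff m (X i * MvPowerSeries.pderiv 𝕜 i (Y j)) = 0 := fun i => by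
    rw [mul_comm]
    exact coeff_mul_eq_zero _ _ (coeff_pderiv_eq_zero _ (hY j) i) m hm
  have h2 : ∀ i, MvPowerSeries.coeff m (Y i * MvPowerSeries.pderiv 𝕜 i (X j)) = 0 := fun i =>
    coeff_mul_eq_zero _ _ (vanishing_anti (Nat.le_succ d) hY i) m hm
  simp [h1, h2]

variable (𝕜 n) in
/-- The subalgebras `L_d(n)`, `d ≥ 0`, as a basis of neighbourhoods of `0` in `W_n`. -/
@[reducible]
noncomputable def filterBasis : AddGroupFilterBasis (FormalVectorField 𝕜 n) :=
  addGroupFilterBasisOfComm (Set.range fun d => (vanishing 𝕜 n d : Set (FormalVectorField 𝕜 n)))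
    (Set.range_nonempty _)
    (by
      rintro _ _ ⟨d, rfl⟩ ⟨e, rfl⟩
      exact ⟨_, ⟨max d e, rfl⟩, Set.subset_inter (vanishing_anti (le_max_left d e))
        (vanishing_anti (le_max_right d e))⟩)
    (by
      rintro _ ⟨d, rfl⟩
      exact (vanishing 𝕜 n d).zero_mem)
    (by
      rintro _ ⟨d, rfl⟩
      refine ⟨_, ⟨d, rfl⟩, ?_⟩
      rintro _ ⟨X, hX, Y, hY, rfl⟩
      exact (vanishing 𝕜 n d).add_mem hX hY)
    (by
      rintro _ ⟨d, rfl⟩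
      exact ⟨_, ⟨d, rfl⟩, fun X hX => (vanishing 𝕜 n d).neg_mem hX⟩)

/-- The topology of `W_n`: the translation-invariant topology in which the `L_d(n)` form a basis
of neighbourhoods of `0`. -/
noncomputable instance : TopologicalSpace (FormalVectorField 𝕜 n) := (filterBasis 𝕜 n).topology

instance : IsTopologicalAddGroup (FormalVectorField 𝕜 n) :=
  (filterBasis 𝕜 n).isTopologicalAddGroup

theorem nhds_zero_hasBasis : (𝓝 (0 : FormalVectorField 𝕜 n)).HasBasis (fun _ : ℕ => True)
    fun d => (vanishing 𝕜 n d : Set (FormalVectorField 𝕜 n)) := by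
  refine (filterBasis 𝕜 n).nhds_zero_hasBasis.to_hasBasis ?_ ?_
  · rintro _ ⟨d, rfl⟩
    exact ⟨d, trivial, subset_rfl⟩
  · exact fun d _ => ⟨_, ⟨d, rfl⟩, subset_rfl⟩

instance : LieCohomology.ContinuousLie (FormalVectorField 𝕜 n) where
  continuous_lie := by
    rw [continuous_iff_continuousAt]
    rintro ⟨X, Y⟩
    have hmap : ∀ Z : FormalVectorField 𝕜 n, (𝓝 Z).HasBasis (fun _ : ℕ => True)
        fun d => {Z' | Z' - Z ∈ vanishing 𝕜 n d} := by
      intro Z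
      rw [← nhds_translation_sub Z]
      exact nhds_zero_hasBasis.comap _
    rw [ContinuousAt, nhds_prod_eq, ((hmap X).prod (hmap Y)).tendsto_iff (hmap ⁅X, Y⁆)]
    rintro d -
    refine ⟨(d + 1, d + 1), ⟨trivial, trivial⟩, ?_⟩
    rintro ⟨X', Y'⟩ ⟨hX, hY⟩
    have h : ⁅X', Y'⁆ - ⁅X, Y⁆ = ⁅X', Y' - Y⁆ - ⁅Y, X' - X⁆ := by
      rw [lie_sub, lie_sub, ← lie_skew X' Y, ← lie_skew X Y]
      abel
    change ⁅X', Y'⁆ - ⁅X, Y⁆ ∈ vanishing 𝕜 n d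
    rw [h]
    exact (vanishing 𝕜 n d).sub_mem (lie_mem_vanishing _ hY) (lie_mem_vanishing _ hX)

/-- `L_d(n)` carries the subspace topology. -/
instance (d : ℕ) : LieCohomology.ContinuousLie (vanishing 𝕜 n d) where
  continuous_lie := by
    have hp : Continuous fun p : vanishing 𝕜 n d × vanishing 𝕜 n d =>
        ((p.1 : FormalVectorField 𝕜 n), (p.2 : FormalVectorField 𝕜 n)) :=
      Continuous.prodMap continuous_subtype_val continuous_subtype_val
    have h := Continuous.comp
      (g := fun p : FormalVectorField 𝕜 n × FormalVectorField 𝕜 n => ⁅p.1, p.2⁆)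
      LieCohomology.ContinuousLie.continuous_lie hp
    rw [continuous_induced_rng]
    exact h

end FormalVectorField

/-! ### Ideals of diagonals and of coordinate slots -/

namespace SlotPoly

open MvPolynomial

section Ideals

variable {K : Type*} [Field K] {n m : ℕ}

/-! A continuous form on L_d(n) sees only finitely many Taylor coefficients: it vanishes as soon as
one argument lies in some L_N(n) (`exists_killed`). For a fixed N such forms make up a
finite-dimensional space. It is therefore enough to find one N, depending on n, d and k only, such
that every k-cocycle is cohomologous to a form killed by L_N(n). Polynomial fields are dense, so
this becomes a statement about forms on polynomial fields that are killed by some order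
(`exists_finExact_killedOn`).

The Euler field E multiplies a homogeneous tensor of fields by its weight, the total degree minus
the number of slots. If d ≤ 1, then E lies in the algebra, and Cartan's formula makes every part of
nonzero weight exact. The part of weight zero reads one single degree, so it is killed by a fixed
order.

If d ≥ 2, then E is not available. The substitute is `exists_primitive`: a form closed on fields of
order e is exact on fields of order e', with e' independent of the form. Dually, the form f has to
vanish on cycles z of high order and nonzero weight. Cartan's formula gives weight · f(z) = ± df(E ⊗
z), but df is controlled only where all slots have order e. Regard tensors as polynomials in one set
of variables per slot. The Artin–Rees lemma, together with the fact that the ideal of one slot lies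
in the sum of the ideal of another slot and that of their diagonal, gives a splitting E ⊗ z = h + r:
here h has high order in every slot, and r vanishes to high order on the diagonals through the new
slot. Then df(h) = 0. A bracket differentiates once and then restricts to a diagonal, so in ∂r the
new slot takes part in no bracket. Thus f(z) is a multiple of f(∂'r), where ∂' leaves the new slot
inert. After antisymmetrization ∂'r is again a cycle, and it equals -∂'h, so it has high order too.
Repeating this makes one more slot inert each time, until no two active slots remain
(`hat_eq_zero_of_cycle`).

Finally one climbs from order e' back to order d by adjoining one field ω at a time. Contraction
with ω lowers the degree of the form, which allows an induction on the degree in the manner of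
Hochschild and Serre (`Reducible.sup_span`, `reducible_sup_span`). -/

theorem derivation_mem_pow {R A : Type*} [CommRing R] [CommRing A] [Algebra R A]
    (D : Derivation R A A) (I : Ideal A) (k : ℕ) {x : A} (hx : x ∈ I ^ (k + 1)) :
    D x ∈ I ^ k := by
  induction k generalizing x with
  | zero => simp
  | succ k ih =>
    rw [pow_succ'] at hx
    refine Submodule.mul_induction_on hx (fun a ha b hb => ?_) (fun a b ha hb => ?_)
    · rw [Derivation.leibniz, smul_eq_mul, smul_eq_mul, pow_succ']
      refine add_mem (Ideal.mul_mem_mul ha (ih hb)) ?_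
      rw [← pow_succ']
      exact Ideal.mul_mem_right _ _ hb
    · rw [map_add]
      exact add_mem ha hb

/-- The ideal generated by the variables of the `i`-th slot. -/
noncomputable def slotIdeal (K : Type*) [Field K] (n : ℕ) {m : ℕ} (i : Fin m) :
    Ideal (MvPolynomial (Fin m × Fin n) K) :=
  Ideal.span (Set.range fun a => X (i, a))

/-- The ideal of the diagonal on which the slots `i` and `j` agree. -/
noncomputable def diagIdeal (K : Type*) [Field K] (n : ℕ) {m : ℕ} (i j : Fin m) :
    Ideal (MvPolynomial (Fin m × Fin n) K) :=
  Ideal.span (Set.range fun a => X (i, a) - X (j, a))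

/-- The product of all slot ideals. -/
noncomputable def axesIdeal (K : Type*) [Field K] (n m : ℕ) :
    Ideal (MvPolynomial (Fin m × Fin n) K) :=
  ∏ i : Fin m, slotIdeal K n i

/-- Polynomials vanishing to order `s` on all diagonals involving one of the first `a` slots. -/
noncomputable def diagPow (K : Type*) [Field K] (n a m s : ℕ) :
    Ideal (MvPolynomial (Fin m × Fin n) K) :=
  ⨅ i : Fin m, ⨅ _ : (i : ℕ) < a, ⨅ j : Fin m, ⨅ _ : j ≠ i, diagIdeal K n i j ^ s

theorem mem_diagPow {a s : ℕ} {g : MvPolynomial (Fin m × Fin n) K} :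
    g ∈ diagPow K n a m s ↔
      ∀ i : Fin m, (i : ℕ) < a → ∀ j : Fin m, j ≠ i → g ∈ diagIdeal K n i j ^ s := by
  simp [diagPow, Submodule.mem_iInf]

theorem diagIdeal_comm (i j : Fin m) : diagIdeal K n i j = diagIdeal K n j i := by
  apply le_antisymm <;>
  · refine Ideal.span_le.2 ?_
    rintro _ ⟨a, rfl⟩
    simp only [SetLike.mem_coe]
    rw [← neg_sub]
    exact neg_mem (Ideal.subset_span ⟨a, rfl⟩)

theorem diagIdeal_self (i : Fin m) : diagIdeal K n i i = ⊥ := by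
  rw [diagIdeal, Ideal.span_eq_bot]
  rintro _ ⟨a, rfl⟩
  simp

/-- Substituting slots along a map of index sets. -/
noncomputable abbrev slotMap {m m' : ℕ} (π : Fin m → Fin m') :
    MvPolynomial (Fin m × Fin n) K →ₐ[K] MvPolynomial (Fin m' × Fin n) K :=
  rename (Prod.map π id)

theorem map_diagIdeal {m' : ℕ} (π : Fin m → Fin m') (i j : Fin m) :
    (diagIdeal K n i j).map (slotMap (n := n) (K := K) π) = diagIdeal K n (π i) (π j) := by
  rw [diagIdeal, Ideal.map_span, ← Set.range_comp]
  congr 2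
  funext a
  simp

theorem map_slotIdeal {m' : ℕ} (π : Fin m → Fin m') (i : Fin m) :
    (slotIdeal K n i).map (slotMap (n := n) (K := K) π) = slotIdeal K n (π i) := by
  rw [slotIdeal, Ideal.map_span, ← Set.range_comp]
  congr 2
  funext a
  simp

theorem map_axesIdeal {m' : ℕ} (π : Fin m → Fin m') :
    (axesIdeal K n m).map (slotMap (n := n) (K := K) π) = ∏ i, slotIdeal K n (π i) := by
  rw [axesIdeal, ← Ideal.mapHom_apply, map_prod]
  simp only [Ideal.mapHom_apply, map_slotIdeal]

theorem slotMap_mem_diagIdeal_pow {m' : ℕ} (π : Fin m → Fin m') (i j : Fin m) (s : ℕ)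
    {g : MvPolynomial (Fin m × Fin n) K} (hg : g ∈ diagIdeal K n i j ^ s) :
    slotMap π g ∈ diagIdeal K n (π i) (π j) ^ s := by
  rw [← map_diagIdeal, ← Ideal.map_pow]
  exact Ideal.mem_map_of_mem _ hg

theorem slotMap_mem_axesIdeal_pow {m' : ℕ} (π : Fin m → Fin m')
    (hπ : ∏ i, slotIdeal K n (π i) ≤ axesIdeal K n m') (s : ℕ)
    {g : MvPolynomial (Fin m × Fin n) K} (hg : g ∈ axesIdeal K n m ^ s) :
    slotMap π g ∈ axesIdeal K n m' ^ s := by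
  have h := Ideal.mem_map_of_mem (slotMap (n := n) (K := K) π) hg
  rw [Ideal.map_pow, map_axesIdeal] at h
  exact Ideal.pow_right_mono hπ s h

theorem prod_slotIdeal_perm (σ : Equiv.Perm (Fin m)) :
    ∏ i, slotIdeal K n (σ i) = axesIdeal K n m :=
  Equiv.prod_comp σ fun i => slotIdeal K n i

/-- Merging slot `r` into slot `i` merely duplicates the factor of slot `i`; hence powers of
`axesIdeal` survive a bracket. -/
theorem prod_slotIdeal_insertNth (r : Fin (m + 1)) (i : Fin m) :
    ∏ l : Fin (m + 1), slotIdeal K n ((r.insertNth i id : Fin (m + 1) → Fin m) l)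
      ≤ axesIdeal K n m := by
  rw [Fin.prod_univ_succAbove _ r]
  simp only [Fin.insertNth_apply_same, Fin.insertNth_apply_succAbove, id]
  exact Ideal.mul_le_right

theorem axesIdeal_pow_le (i : Fin m) (s : ℕ) : axesIdeal K n m ^ s ≤ slotIdeal K n i ^ s :=
  Ideal.pow_right_mono (Ideal.prod_le_inf.trans (Finset.inf_le (Finset.mem_univ i))) s

/-- Each factor from the slot ideal raises the degree in that slot by at least one. This converts
ideal membership into a lower bound for the order of the monomial fields occurring in a chain. -/
theorem slotDegree_of_mem_slotIdeal_pow (i : Fin m) (s : ℕ)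
    {g : MvPolynomial (Fin m × Fin n) K} (hg : g ∈ slotIdeal K n i ^ s)
    (α : Fin m × Fin n →₀ ℕ) (hα : ∑ a, α (i, a) < s) : coeff α g = 0 := by
  classical
  induction s generalizing g α with
  | zero => simp at hα
  | succ s ih =>
    rw [pow_succ'] at hg
    refine Submodule.mul_induction_on hg (fun x hx y hy => ?_) (fun x y hx hy => ?_)
    · rw [slotIdeal] at hx
      refine Submodule.span_induction
        (p := fun x _ => ∀ y ∈ slotIdeal K n i ^ s, coeff α (x * y) = 0) ?_ ?_ ?_ ?_ hx y hy
      · rintro _ ⟨a, rfl⟩ y hy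
        rw [mul_comm, coeff_mul_X']
        split_ifs with h
        · refine ih hy _ ?_
          have h0 : α (i, a) ≠ 0 := by simpa using h
          refine lt_of_lt_of_le (Finset.sum_lt_sum (fun b _ => tsub_le_self)
            ⟨a, Finset.mem_univ a, ?_⟩) (Nat.lt_succ_iff.1 hα)
          rw [Finsupp.coe_tsub, Pi.sub_apply, Finsupp.single_eq_same]
          omega
        · rfl
      · simp
      · intro x z _ _ hx hz y hy
        rw [add_mul, coeff_add, hx y hy, hz y hy, add_zero]
      · intro c x _ hx y hy
        rw [smul_eq_mul, mul_comm c, mul_assoc]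
        exact hx _ (Ideal.mul_mem_left _ _ hy)
    · rw [coeff_add, hx, hy, add_zero]

/-! ### Splitting off a new slot by the Artin–Rees lemma -/

theorem prod_sup_le {R ι : Type*} [CommSemiring R] (J : Ideal R) (L : ι → Ideal R) (t : Finset ι) :
    ∏ i ∈ t, (J ⊔ L i) ≤ J ⊔ ∏ i ∈ t, L i := by
  classical
  induction t using Finset.induction_on with
  | empty => simp
  | insert i t hi ih =>
    rw [Finset.prod_insert hi, Finset.prod_insert hi]
    refine (Ideal.mul_mono_right ih).trans ?_
    rw [Ideal.sup_mul, Ideal.mul_sup (L i)]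
    exact sup_le (Ideal.mul_le_left.trans le_sup_left)
      (sup_le (Ideal.mul_le_right.trans le_sup_left) le_sup_right)

theorem slotIdeal_le_sup (i j : Fin m) :
    slotIdeal K n i ≤ slotIdeal K n j ⊔ diagIdeal K n j i := by
  refine Ideal.span_le.2 ?_
  rintro _ ⟨a, rfl⟩
  have : (X (i, a) : MvPolynomial (Fin m × Fin n) K)
      = X (j, a) - (X (j, a) - X (i, a)) := by ring
  simp only [SetLike.mem_coe]
  rw [this]
  exact sub_mem (Submodule.mem_sup_left (Ideal.subset_span ⟨a, rfl⟩))
    (Submodule.mem_sup_right (Ideal.subset_span ⟨a, rfl⟩))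

/-- A polynomial vanishing to high order on the axes and to order `s` on the first diagonals is,
in one more slot, a sum of one vanishing on the axes and one vanishing on the diagonals. -/
theorem slotMap_succ_mem_sup (B s a q : ℕ) :
    ∃ A, ∀ g ∈ axesIdeal K n q ^ A ⊓ diagPow K n a q s,
      slotMap Fin.succ g ∈ axesIdeal K n (q + 1) ^ B ⊔ diagPow K n (a + 1) (q + 1) s := by
  obtain ⟨c, hc⟩ := Ideal.exists_pow_inf_eq_pow_smul (axesIdeal K n q)
    (diagPow K n a q s : Submodule (MvPolynomial (Fin q × Fin n) K) _)
  -- Here `c` is the Artin–Rees constant. Of the remaining exponent, one `B` is kept as order in the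
  -- old slots, while `B + s` is spent in `hprod` to gain either order `B` in the new slot or order
  -- `s` on every diagonal through it.
  refine ⟨c + (B + (B + s)), fun g hg => ?_⟩
  have h1 : g ∈ axesIdeal K n q ^ (B + (B + s)) * diagPow K n a q s := by
    have h := hc (c + (B + (B + s))) (Nat.le_add_right _ _)
    rw [Nat.add_sub_cancel_left, smul_eq_mul, Ideal.mul_top] at h
    rw [h, smul_eq_mul] at hg
    exact Ideal.mul_mono_right inf_le_right hg
  have h2 := Ideal.mem_map_of_mem (slotMap (n := n) (K := K) (Fin.succ : Fin q → Fin (q + 1))) h1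
  rw [Ideal.map_mul, Ideal.map_pow, map_axesIdeal] at h2
  have hprod : (∏ i : Fin q, slotIdeal K n i.succ) ^ (B + s)
      ≤ slotIdeal K n (0 : Fin (q + 1)) ^ B ⊔ ∏ i : Fin q, diagIdeal K n 0 i.succ ^ s := by
    rw [← Finset.prod_pow]
    refine le_trans ?_ (prod_sup_le _ _ _)
    refine Finset.prod_le_prod' fun i _ => ?_
    exact (Ideal.pow_right_mono (slotIdeal_le_sup i.succ 0) _).trans
      Ideal.sup_pow_add_le_pow_sup_pow
  rw [pow_add, mul_comm (_ ^ B), mul_assoc] at h2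
  refine SetLike.le_def.1 ?_ (Ideal.mul_mono_left hprod h2)
  rw [Ideal.sup_mul]
  refine sup_le_sup ?_ ?_
  · rw [← mul_assoc, axesIdeal, Fin.prod_univ_succ, mul_pow]
    exact Ideal.mul_le_left
  · intro x hx
    have hx1 : x ∈ ∏ i : Fin q, diagIdeal K n (0 : Fin (q + 1)) i.succ ^ s :=
      Ideal.mul_le_left hx
    have hx2 : x ∈ (diagPow K n a q s).map
        (slotMap (n := n) (K := K) (Fin.succ : Fin q → Fin (q + 1))) :=
      Ideal.mul_le_right (Ideal.mul_le_right hx)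
    have h0 : ∀ j : Fin q, x ∈ diagIdeal K n (0 : Fin (q + 1)) j.succ ^ s := fun j =>
      (Ideal.prod_le_inf.trans (Finset.inf_le (Finset.mem_univ j))) hx1
    rw [mem_diagPow]
    intro i hi j hj
    induction i using Fin.cases with
    | zero =>
      induction j using Fin.cases with
      | zero => exact absurd rfl hj
      | succ j => exact h0 j
    | succ i =>
      induction j using Fin.cases with
      | zero =>
        rw [diagIdeal_comm]
        exact h0 i
      | succ j =>
        rw [← map_diagIdeal, ← Ideal.map_pow]
        refine Ideal.map_mono (fun y hy => ?_) hx2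
        exact mem_diagPow.1 hy i (by simpa using hi) j fun h => hj (by rw [h])

/-- An ideal containing the homogeneous components of its elements. -/
def ContainsComponents {σ : Type*} (I : Ideal (MvPolynomial σ K)) : Prop :=
  ∀ g ∈ I, ∀ k, homogeneousComponent k g ∈ I

attribute [local instance] MvPolynomial.gradedAlgebra

theorem containsComponents_of_isHomogeneous {σ : Type*} {I : Ideal (MvPolynomial σ K)}
    (hI : I.IsHomogeneous (homogeneousSubmodule σ K)) : ContainsComponents I := by
  intro g hg k
  have h := hI k hg
  rwa [← decomposition.decompose'_apply]

theorem isHomogeneous_pow {σ : Type*} {I : Ideal (MvPolynomial σ K)}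
    (hI : I.IsHomogeneous (homogeneousSubmodule σ K)) (s : ℕ) :
    (I ^ s).IsHomogeneous (homogeneousSubmodule σ K) := by
  induction s with
  | zero => rw [pow_zero, Ideal.one_eq_top]; exact Ideal.IsHomogeneous.top _
  | succ s ih => rw [pow_succ]; exact ih.mul hI

theorem isHomogeneous_prod {σ ι : Type*} {I : ι → Ideal (MvPolynomial σ K)} (t : Finset ι)
    (hI : ∀ i, (I i).IsHomogeneous (homogeneousSubmodule σ K)) :
    (∏ i ∈ t, I i).IsHomogeneous (homogeneousSubmodule σ K) := by
  classical
  induction t using Finset.induction_on with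
  | empty => rw [Finset.prod_empty, Ideal.one_eq_top]; exact Ideal.IsHomogeneous.top _
  | insert i t hi ih => rw [Finset.prod_insert hi]; exact (hI i).mul ih

theorem isHomogeneous_slotIdeal (i : Fin m) :
    (slotIdeal K n i).IsHomogeneous (homogeneousSubmodule _ K) := by
  refine Ideal.homogeneous_span _ _ ?_
  rintro _ ⟨a, rfl⟩
  exact ⟨1, isHomogeneous_X _ _⟩

theorem isHomogeneous_diagIdeal (i j : Fin m) :
    (diagIdeal K n i j).IsHomogeneous (homogeneousSubmodule _ K) := by
  refine Ideal.homogeneous_span _ _ ?_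
  rintro _ ⟨a, rfl⟩
  exact ⟨1, (isHomogeneous_X _ _).sub (isHomogeneous_X _ _)⟩

theorem containsComponents_axesIdeal_pow (A : ℕ) :
    ContainsComponents (axesIdeal K n m ^ A) :=
  containsComponents_of_isHomogeneous
    (isHomogeneous_pow (isHomogeneous_prod _ isHomogeneous_slotIdeal) A)

theorem containsComponents_diagPow (a s : ℕ) : ContainsComponents (diagPow K n a m s) := by
  refine containsComponents_of_isHomogeneous ?_
  exact Ideal.IsHomogeneous.iInf fun i => Ideal.IsHomogeneous.iInf fun _ =>
    Ideal.IsHomogeneous.iInf fun j => Ideal.IsHomogeneous.iInf fun _ =>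
      isHomogeneous_pow (isHomogeneous_diagIdeal i j) s

/-- A homogeneous element of a sum of two graded ideals splits homogeneously. -/
theorem exists_isHomogeneous_add {σ : Type*} {I J : Ideal (MvPolynomial σ K)}
    (hI : ContainsComponents I) (hJ : ContainsComponents J) {g : MvPolynomial σ K} {k : ℕ}
    (hg : g.IsHomogeneous k) (hgm : g ∈ I ⊔ J) :
    ∃ h ∈ I, ∃ r ∈ J, h.IsHomogeneous k ∧ r.IsHomogeneous k ∧ g = h + r := by
  obtain ⟨h, hh, r, hr, rfl⟩ := Submodule.mem_sup.1 hgm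
  refine ⟨_, hI h hh k, _, hJ r hr k, homogeneousComponent_isHomogeneous _ _,
    homogeneousComponent_isHomogeneous _ _, ?_⟩
  rw [← map_add, homogeneousComponent_of_mem (m := k) hg, if_pos rfl]

end Ideals

end SlotPoly

/-! ### Chains: polynomial tensors of vector fields -/

/-- Polynomial vector fields in `n` variables. -/
abbrev PolyField (K : Type*) [Field K] (n : ℕ) :=
  Derivation K (MvPolynomial (Fin n) K) (MvPolynomial (Fin n) K)

/-- The `m`-th tensor power of the space of polynomial vector fields in `n` variables. -/
abbrev Chain (K : Type*) [Field K] (n m : ℕ) :=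
  (Fin m → Fin n) → MvPolynomial (Fin m × Fin n) K

namespace Chain

open MvPolynomial SlotPoly LieCohomology

variable {K : Type*} [Field K] {n m : ℕ}

/-- The product of polynomials in separate slots. -/
noncomputable def slotProd (K : Type*) [Field K] (n m : ℕ) :
    MultilinearMap K (fun _ : Fin m => MvPolynomial (Fin n) K) (MvPolynomial (Fin m × Fin n) K) :=
  (MultilinearMap.mkPiAlgebra K (Fin m) (MvPolynomial (Fin m × Fin n) K)).compLinearMap
    fun i => (rename (Prod.mk i)).toLinearMap

theorem slotProd_apply (g : Fin m → MvPolynomial (Fin n) K) :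
    slotProd K n m g = ∏ i, rename (Prod.mk i) (g i) := by
  simp [slotProd]

theorem pderiv_rename_slot (i l : Fin m) (a : Fin n) (g : MvPolynomial (Fin n) K) :
    pderiv (l, a) (rename (Prod.mk i) g)
      = if i = l then rename (Prod.mk i) (pderiv a g) else 0 := by
  classical
  split_ifs with h
  · subst h
    exact pderiv_rename (Prod.mk_right_injective i) a g
  · refine pderiv_eq_zero_of_notMem_vars fun hm => h ?_
    have := vars_rename (Prod.mk i) g hm
    simp only [Finset.mem_image] at this
    obtain ⟨b, _, hb⟩ := this
    exact congrArg Prod.fst hb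

theorem pderiv_slotProd (l : Fin m) (a : Fin n) (g : Fin m → MvPolynomial (Fin n) K) :
    pderiv (l, a) (slotProd K n m g) = slotProd K n m (Function.update g l (pderiv a (g l))) := by
  classical
  rw [slotProd_apply, slotProd_apply, ← Finset.mul_prod_erase _ _ (Finset.mem_univ l),
    ← Finset.mul_prod_erase (a := l) _ _ (Finset.mem_univ l)]
  have h1 : ∀ i ∈ Finset.univ.erase l,
      rename (Prod.mk i) (Function.update g l (pderiv a (g l)) i) = rename (Prod.mk i) (g i) :=
    fun i hi => by rw [Function.update_of_ne (Finset.ne_of_mem_erase hi)]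
  have h2 : pderiv (l, a) (∏ i ∈ Finset.univ.erase l, rename (Prod.mk i) (g i)) = 0 := by
    refine Finset.prod_induction _ (fun x => pderiv (l, a) x = 0) ?_ ?_ ?_
    · intro x y hx hy
      rw [pderiv_mul, hx, hy, zero_mul, mul_zero, add_zero]
    · exact pderiv_one
    · intro i hi
      rw [pderiv_rename_slot, if_neg (Finset.ne_of_mem_erase hi)]
  rw [Finset.prod_congr rfl h1, pderiv_mul, h2, mul_zero, add_zero, pderiv_rename_slot,
    if_pos rfl, Function.update_self]

theorem slotMap_slotProd {m' : ℕ} (π : Fin m → Fin m') (g : Fin m → MvPolynomial (Fin n) K) :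
    slotMap π (slotProd K n m g) = ∏ i, rename (Prod.mk (π i)) (g i) := by
  rw [slotProd_apply, map_prod]
  refine Finset.prod_congr rfl fun i _ => ?_
  rw [slotMap, rename_rename]
  rfl

theorem slotMap_insertNth_slotProd (r : Fin (m + 1)) (i : Fin m)
    (g : Fin (m + 1) → MvPolynomial (Fin n) K) :
    slotMap (r.insertNth i id : Fin (m + 1) → Fin m) (slotProd K n (m + 1) g)
      = slotProd K n m (Function.update (r.removeNth g) i (g (r.succAbove i) * g r)) := by
  classical
  rw [slotMap_slotProd, Fin.prod_univ_succAbove _ r, slotProd_apply]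
  simp only [Fin.insertNth_apply_same, Fin.insertNth_apply_succAbove, id]
  rw [← Finset.mul_prod_erase _ _ (Finset.mem_univ i),
    ← Finset.mul_prod_erase (a := i) _ _ (Finset.mem_univ i), Function.update_self, map_mul,
    ← mul_assoc, mul_comm (rename (Prod.mk i) (g r))]
  congr 1
  refine Finset.prod_congr rfl fun l hl => ?_
  rw [Function.update_of_ne (Finset.ne_of_mem_erase hl)]
  rfl

/-- Evaluation of a vector field at a coordinate function. -/
noncomputable def component (K : Type*) [Field K] {n : ℕ} (a : Fin n) :
    PolyField K n →ₗ[K] MvPolynomial (Fin n) K where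
  toFun u := u (X a)
  map_add' _ _ := rfl
  map_smul' _ _ := rfl

/-- The tensor product of vector fields. -/
noncomputable def tens (K : Type*) [Field K] (n m : ℕ) :
    MultilinearMap K (fun _ : Fin m => PolyField K n) (Chain K n m) :=
  MultilinearMap.pi fun p => (slotProd K n m).compLinearMap fun i => component K (p i)

theorem tens_apply (u : Fin m → PolyField K n) (p : Fin m → Fin n) :
    tens K n m u p = slotProd K n m fun i => u i (X (p i)) := rfl

/-- The vector field `x^α ∂_a`. -/
noncomputable def monoField (K : Type*) [Field K] {n : ℕ} (α : Fin n →₀ ℕ) (a : Fin n) :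
    PolyField K n :=
  mkDerivation K (Pi.single a (monomial α 1))

theorem monoField_X (α : Fin n →₀ ℕ) (a b : Fin n) :
    monoField K α a (X b) = if b = a then monomial α 1 else 0 := by
  rw [monoField, mkDerivation_X, Pi.single_apply]

/-- The basis of monomial vector fields. -/
noncomputable def fieldBasis (K : Type*) [Field K] (n : ℕ) :
    Module.Basis ((_ : Fin n) × (Fin n →₀ ℕ)) K (PolyField K n) :=
  (Pi.basis fun _ : Fin n => basisMonomials (Fin n) K).map (mkDerivationEquiv K)

theorem fieldBasis_apply (x : (_ : Fin n) × (Fin n →₀ ℕ)) :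
    fieldBasis K n x = monoField K x.2 x.1 := by
  rw [fieldBasis, Module.Basis.map_apply, Pi.basis_apply, coe_basisMonomials]
  rfl

/-- The tuple of monomial vector fields with exponents `α` and directions `p`. -/
noncomputable def slotFields (K : Type*) [Field K] {n m : ℕ} (α : Fin m × Fin n →₀ ℕ)
    (p : Fin m → Fin n) : Fin m → PolyField K n :=
  fun i => monoField K (α.curry i) (p i)

/-- Monomials in disjoint sets of variables multiply to monomials, so pure tensors of monomial
fields form the monomial basis of `Chain`. A linear map on chains is thus determined by its values
on pure tensors. -/
theorem tens_slotFields (α : Fin m × Fin n →₀ ℕ) (p : Fin m → Fin n) :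
    tens K n m (slotFields K α p) = Pi.single p (monomial α 1) := by
  funext p'
  rw [tens_apply, slotProd_apply, Pi.single_apply]
  simp only [slotFields, monoField_X]
  split_ifs with h
  · subst h
    simp only [if_true, rename_monomial]
    rw [← monomial_sum_one]
    refine congrArg (fun β => monomial β (1 : K)) (Finsupp.ext fun ⟨i, a⟩ => ?_)
    rw [Finsupp.finsetSum_apply, Finset.sum_eq_single i]
    · rw [Finsupp.mapDomain_apply (Prod.mk_right_injective i), Finsupp.curry_apply]
    · intro j _ hj
      refine Finsupp.mapDomain_of_notMem_range _ _ ?_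
      rintro ⟨b, hb⟩
      exact hj (congrArg Prod.fst hb)
    · exact fun h => absurd (Finset.mem_univ i) h
  · obtain ⟨i, hi⟩ := Function.ne_iff.1 h
    refine Finset.prod_eq_zero (Finset.mem_univ i) ?_
    rw [if_neg hi, map_zero]

theorem sum_single_monomial (z : Chain K n m) :
    z = ∑ p, ∑ α ∈ (z p).support, coeff α (z p) • tens K n m (slotFields K α p) := by
  funext p
  rw [Finset.sum_apply, Finset.sum_eq_single p]
  · rw [Finset.sum_apply]
    conv_lhs => rw [(z p).as_sum]
    refine Finset.sum_congr rfl fun α _ => ?_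
    rw [tens_slotFields, Pi.smul_apply, Pi.single_eq_same, smul_monomial, smul_eq_mul, mul_one]
  · intro q _ hq
    rw [Finset.sum_apply]
    refine Finset.sum_eq_zero fun α _ => ?_
    rw [tens_slotFields, Pi.smul_apply, Pi.single_eq_of_ne' hq, smul_zero]
  · exact fun h => absurd (Finset.mem_univ p) h

theorem hom_ext_tens {W : Type*} [AddCommGroup W] [Module K W] {F G : Chain K n m →ₗ[K] W}
    (h : ∀ u, F (tens K n m u) = G (tens K n m u)) : F = G := by
  refine LinearMap.ext fun z => ?_
  rw [sum_single_monomial z]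
  simp only [map_sum, map_smul, h]

/-- The linear extension of a multilinear form to chains. -/
noncomputable def hat (f : MultilinearMap K (fun _ : Fin m => PolyField K n) K) :
    Chain K n m →ₗ[K] K :=
  ∑ p, ((basisMonomials (Fin m × Fin n) K).constr K fun α => f (slotFields K α p)) ∘ₗ
    LinearMap.proj p

theorem hat_apply (f : MultilinearMap K (fun _ : Fin m => PolyField K n) K) (z : Chain K n m) :
    hat f z = ∑ p, ∑ α ∈ (z p).support, coeff α (z p) * f (slotFields K α p) := by
  rw [hat, LinearMap.sum_apply]
  refine Finset.sum_congr rfl fun p _ => ?_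
  rw [LinearMap.comp_apply, LinearMap.proj_apply, Module.Basis.constr_apply]
  rfl

theorem hat_tens (f : MultilinearMap K (fun _ : Fin m => PolyField K n) K)
    (u : Fin m → PolyField K n) : hat f (tens K n m u) = f u := by
  suffices h : (hat f).compMultilinearMap (tens K n m) = f from congrArg (fun F => F u) h
  refine Module.Basis.ext_multilinear (fun _ => fieldBasis K n) fun v => ?_
  simp only [fieldBasis_apply]
  have hv : (fun i => monoField K (v i).2 (v i).1)
      = slotFields K (Finsupp.curryEquiv.symm (Finsupp.equivFunOnFinite.symm fun i => (v i).2))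
          fun i => (v i).1 := by
    funext i
    rw [slotFields]
    congr 1
    exact (congrArg (fun F => F i) (Finsupp.curryEquiv.apply_symm_apply
      (Finsupp.equivFunOnFinite.symm fun i => (v i).2))).symm
  rw [hv, LinearMap.compMultilinearMap_apply, tens_slotFields, hat_apply, Finset.sum_eq_single]
  · classical
    rw [Pi.single_eq_same, support_monomial, if_neg one_ne_zero, Finset.sum_singleton,
      coeff_monomial, if_pos rfl, one_mul]
  · intro q _ hq
    rw [Pi.single_eq_of_ne hq, support_zero, Finset.sum_empty]
  · exact fun h => absurd (Finset.mem_univ _) h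

theorem hat_eq_mul_hat (f g : MultilinearMap K (fun _ : Fin m => PolyField K n) K) (c : K)
    (z : Chain K n m)
    (h : ∀ p, ∀ α ∈ (z p).support, f (slotFields K α p) = c * g (slotFields K α p)) :
    hat f z = c * hat g z := by
  rw [hat_apply, hat_apply, Finset.mul_sum]
  refine Finset.sum_congr rfl fun p _ => ?_
  rw [Finset.mul_sum]
  refine Finset.sum_congr rfl fun α hα => ?_
  rw [h p α hα]
  ring

theorem hat_eq_zero (f : MultilinearMap K (fun _ : Fin m => PolyField K n) K) (z : Chain K n m)
    (h : ∀ p, ∀ α ∈ (z p).support, f (slotFields K α p) = 0) : hat f z = 0 := by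
  rw [hat_eq_mul_hat f 0 0 z fun p α hα => by simp [h p α hα], zero_mul]

theorem sum_pderiv (u : PolyField K n) (g : MvPolynomial (Fin n) K) :
    ∑ a, u (X a) * pderiv a g = u g := by
  classical
  induction g using MvPolynomial.induction_on with
  | C c => simp
  | add p q hp hq => simp only [map_add, mul_add, Finset.sum_add_distrib, hp, hq]
  | mul_X p i hp =>
    simp only [pderiv_mul, mul_add, Finset.sum_add_distrib, ← mul_assoc, ← Finset.sum_mul, hp]
    rw [Finset.sum_eq_single i, Derivation.leibniz, pderiv_X_self]
    · simp only [smul_eq_mul]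
      ring
    · intro a _ ha
      rw [pderiv_X_of_ne ha.symm, mul_zero]
    · simp

/-- The bracket of the slots `r.succAbove i` and `r`, put into slot `i`. -/
noncomputable def bracket (r : Fin (m + 1)) (i : Fin m) : Chain K n (m + 1) →ₗ[K] Chain K n m :=
  LinearMap.pi fun p => ∑ a : Fin n, (slotMap (r.insertNth i id : Fin (m + 1) → Fin m)).toLinearMap ∘ₗ
    ((pderiv (r, a)).toLinearMap ∘ₗ
        LinearMap.proj (r.insertNth (p i) (Function.update p i a) : Fin (m + 1) → Fin n)
      - (pderiv (r.succAbove i, a)).toLinearMap ∘ₗ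
        LinearMap.proj (r.insertNth a p : Fin (m + 1) → Fin n))

theorem bracket_apply (r : Fin (m + 1)) (i : Fin m) (z : Chain K n (m + 1)) (p : Fin m → Fin n) :
    bracket r i z p = ∑ a : Fin n, slotMap (r.insertNth i id : Fin (m + 1) → Fin m)
      (pderiv (r, a) (z (r.insertNth (p i) (Function.update p i a) : Fin (m + 1) → Fin n))
        - pderiv (r.succAbove i, a) (z (r.insertNth a p : Fin (m + 1) → Fin n))) := by
  simp [bracket]

/-- The two terms of `bracket` are those of [X, Y]_p = ∑_a (X_a ∂_a Y_p - Y_a ∂_a X_p), with the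
differentiation carried out before the two slots are identified. In this form a bracket is a
first-order operator followed by restriction to a diagonal. -/
theorem bracket_tens (r : Fin (m + 1)) (i : Fin m) (u : Fin (m + 1) → PolyField K n) :
    bracket r i (tens K n (m + 1) u)
      = tens K n m (Function.update (r.removeNth u) i ⁅u (r.succAbove i), u r⁆) := by
  funext p
  rw [bracket_apply, tens_apply]
  have hr : (fun l => (Function.update (r.removeNth u) i ⁅u (r.succAbove i), u r⁆) l (X (p l)))
      = Function.update (fun l => u (r.succAbove l) (X (p l))) i
          (⁅u (r.succAbove i), u r⁆ (X (p i))) := by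
    funext l
    by_cases h : l = i
    · subst h; simp
    · simp [Function.update_of_ne h, Fin.removeNth]
  rw [hr, Derivation.commutator_apply, ← sum_pderiv (u (r.succAbove i)) (u r _),
    ← sum_pderiv (u r) (u (r.succAbove i) _),
    ← Finset.sum_sub_distrib, MultilinearMap.map_update_sum]
  refine Finset.sum_congr rfl fun a _ => ?_
  rw [MultilinearMap.map_update_sub, map_sub, tens_apply, tens_apply, pderiv_slotProd,
    pderiv_slotProd, slotMap_insertNth_slotProd, slotMap_insertNth_slotProd]
  congr 2
  · funext l
    by_cases h : l = i
    · subst h; simp [Fin.succAbove_ne]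
    · have : r.succAbove l ≠ r.succAbove i := fun h' => h (Fin.succAbove_right_injective h')
      simp [Function.update_of_ne h, Fin.removeNth, Function.update_of_ne this]
  · funext l
    by_cases h : l = i
    · subst h; simp [Fin.ne_succAbove, mul_comm]
    · simp [Function.update_of_ne h, Fin.removeNth]

end Chain

/-! ### Boundaries with inert slots and antisymmetrization -/

namespace Chain

open MvPolynomial SlotPoly LieCohomology

variable {K : Type*} [Field K] {n m : ℕ}

/-- The Chevalley–Eilenberg boundary of the slots from `a` on, the first `a` slots being inert. -/
noncomputable def boundary (a : ℕ) : Chain K n (m + 1) →ₗ[K] Chain K n m :=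
  ∑ r : Fin (m + 1), (-1 : K) ^ (r : ℕ) • ∑ i : Fin m,
    if a ≤ (i : ℕ) ∧ i.castSucc < r then bracket r i else 0

theorem boundary_tens (a : ℕ) (u : Fin (m + 1) → PolyField K n) :
    boundary a (tens K n (m + 1) u) = ∑ r : Fin (m + 1), (-1 : K) ^ (r : ℕ) • ∑ i : Fin m,
      if a ≤ (i : ℕ) ∧ i.castSucc < r then
        tens K n m (Function.update (r.removeNth u) i ⁅u i.castSucc, u r⁆) else 0 := by
  simp only [boundary, LinearMap.sum_apply, LinearMap.smul_apply]
  refine Finset.sum_congr rfl fun r _ => congrArg _ (Finset.sum_congr rfl fun i _ => ?_)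
  split_ifs with h
  · rw [bracket_tens, Fin.succAbove_of_castSucc_lt _ _ h.2]
  · rfl

theorem boundary_eq_zero {a : ℕ} (h : m ≤ a) : (boundary a : Chain K n (m + 1) →ₗ[K] _) = 0 := by
  rw [boundary]
  refine Finset.sum_eq_zero fun r _ => ?_
  rw [Finset.sum_eq_zero, smul_zero]
  intro i _
  rw [if_neg]
  omega

/-- On pure tensors this is the definition of `ceFun`. It turns questions about differentials of
forms into questions about boundaries of chains. -/
theorem hat_ceAlg (f : PolyField K n [⋀^Fin m]→ₗ[K] K) (z : Chain K n (m + 1)) :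
    hat (ceAlg K (PolyField K n) m f).toMultilinearMap z = hat f.toMultilinearMap (boundary 0 z) := by
  suffices h : hat (ceAlg K (PolyField K n) m f).toMultilinearMap
      = hat f.toMultilinearMap ∘ₗ boundary 0 from congrArg (fun F => F z) h
  refine hom_ext_tens fun u => ?_
  rw [hat_tens, LinearMap.comp_apply, boundary_tens]
  simp only [map_sum, map_smul, smul_eq_mul, Nat.zero_le, true_and]
  change ceFun f u = _
  rw [ceFun]
  refine Finset.sum_congr rfl fun r _ => congrArg _ (Finset.sum_congr rfl fun i _ => ?_)
  split_ifs
  · rw [hat_tens]; rfl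
  · rw [map_zero]

/-- Permutation of the slots of a chain. -/
noncomputable def act (σ : Equiv.Perm (Fin m)) : Chain K n m →ₗ[K] Chain K n m :=
  LinearMap.pi fun p => (slotMap ⇑σ⁻¹).toLinearMap ∘ₗ LinearMap.proj (p ∘ ⇑σ⁻¹)

theorem act_apply (σ : Equiv.Perm (Fin m)) (z : Chain K n m) (p : Fin m → Fin n) :
    act σ z p = slotMap ⇑σ⁻¹ (z (p ∘ ⇑σ⁻¹)) := rfl

theorem act_tens (σ : Equiv.Perm (Fin m)) (u : Fin m → PolyField K n) :
    act σ (tens K n m u) = tens K n m (u ∘ σ) := by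
  funext p
  rw [act_apply, tens_apply, slotMap_slotProd, tens_apply, slotProd_apply]
  refine Fintype.prod_equiv σ⁻¹ _ _ fun i => ?_
  simp

/-- Antisymmetrization over the slots from `a` on. -/
noncomputable def skew (a : ℕ) : Chain K n m →ₗ[K] Chain K n m :=
  ∑ σ : Equiv.Perm (Fin m), if ∀ i : Fin m, (i : ℕ) < a → σ i = i then
    ((Equiv.Perm.sign σ : ℤ) : K) • act σ else 0

theorem skew_tens (a : ℕ) (u : Fin m → PolyField K n) :
    skew a (tens K n m u) = ∑ σ : Equiv.Perm (Fin m),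
      if ∀ i : Fin m, (i : ℕ) < a → σ i = i then
        ((Equiv.Perm.sign σ : ℤ) : K) • tens K n m (u ∘ σ) else 0 := by
  simp only [skew, LinearMap.sum_apply]
  refine Finset.sum_congr rfl fun σ _ => ?_
  split_ifs
  · rw [LinearMap.smul_apply, act_tens]
  · rfl

/-- Every permutation contributes the same value, because the sign occurs twice. `N` counts the
permutations fixing the first `a` slots, and it is nonzero in characteristic 0. -/
theorem exists_hat_skew [CharZero K] (a m : ℕ) : ∃ N : K, N ≠ 0 ∧
    ∀ (f : PolyField K n [⋀^Fin m]→ₗ[K] K) (z : Chain K n m),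
      hat f.toMultilinearMap (skew a z) = N * hat f.toMultilinearMap z := by
  classical
  refine ⟨((Finset.univ.filter fun σ : Equiv.Perm (Fin m) =>
    ∀ i : Fin m, (i : ℕ) < a → σ i = i).card : K), ?_, fun f z => ?_⟩
  · rw [Nat.cast_ne_zero, ← Nat.pos_iff_ne_zero, Finset.card_pos]
    exact ⟨1, by simp⟩
  · set N : ℕ := (Finset.univ.filter fun σ : Equiv.Perm (Fin m) =>
      ∀ i : Fin m, (i : ℕ) < a → σ i = i).card with hN
    suffices h : hat f.toMultilinearMap ∘ₗ skew a = (N : K) • hat f.toMultilinearMap from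
      congrArg (fun F => F z) h
    refine hom_ext_tens fun u => ?_
    rw [LinearMap.comp_apply, skew_tens, LinearMap.smul_apply, map_sum, hat_tens, smul_eq_mul, hN,
      Finset.card_eq_sum_ones, Nat.cast_sum, Finset.sum_filter, Finset.sum_mul]
    refine Finset.sum_congr rfl fun σ _ => ?_
    split_ifs
    · rw [map_smul, hat_tens]
      have h := f.map_perm u σ
      change _ • f (u ∘ σ) = _ * f u
      rw [h, Units.smul_def, zsmul_eq_mul, smul_eq_mul, ← mul_assoc, ← Int.cast_mul]
      norm_cast
      rw [Int.units_mul_self]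
      simp
    · simp

/-- Tensoring a vector field in a new first slot. -/
noncomputable def cons (y : PolyField K n) : Chain K n m →ₗ[K] Chain K n (m + 1) :=
  LinearMap.pi fun p => LinearMap.mulLeft K (rename (Prod.mk 0) (y (X (p 0)))) ∘ₗ
    (slotMap Fin.succ).toLinearMap ∘ₗ LinearMap.proj (p ∘ Fin.succ)

theorem cons_apply (y : PolyField K n) (z : Chain K n m) (p : Fin (m + 1) → Fin n) :
    cons y z p = rename (Prod.mk 0) (y (X (p 0))) * slotMap Fin.succ (z (p ∘ Fin.succ)) := rfl

theorem cons_tens (y : PolyField K n) (u : Fin m → PolyField K n) :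
    cons y (tens K n m u) = tens K n (m + 1) (Fin.cons y u : Fin (m + 1) → PolyField K n) := by
  funext p
  rw [cons_apply, tens_apply, tens_apply, slotMap_slotProd, slotProd_apply, Fin.prod_univ_succ]
  simp

/-- The new slot is inert, so only indices shift; the sign comes from the omitted slot moving from
`r` to `r + 1`. -/
theorem boundary_succ_cons (a : ℕ) (y : PolyField K n) (z : Chain K n (m + 1)) :
    boundary (a + 1) (cons y z) = -cons y (boundary a z) := by
  suffices h : (boundary (a + 1)) ∘ₗ (cons y : Chain K n (m + 1) →ₗ[K] _) = -(cons y ∘ₗ boundary a)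
    from congrArg (fun F => F z) h
  refine hom_ext_tens fun u => ?_
  rw [LinearMap.comp_apply, LinearMap.neg_apply, LinearMap.comp_apply, cons_tens, boundary_tens,
    boundary_tens, Fin.sum_univ_succ]
  have h0 : ∑ i : Fin (m + 1), (if a + 1 ≤ (i : ℕ) ∧ i.castSucc < (0 : Fin (m + 2)) then
      tens K n (m + 1) (Function.update ((0 : Fin (m + 2)).removeNth
        (Fin.cons y u : Fin (m + 2) → PolyField K n)) i
        ⁅(Fin.cons y u : Fin (m + 2) → PolyField K n) i.castSucc,
          (Fin.cons y u : Fin (m + 2) → PolyField K n) 0⁆) else 0) = 0 :=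
    Finset.sum_eq_zero fun i _ => if_neg fun h => absurd h.2 (Fin.not_lt_zero _)
  rw [h0, smul_zero, zero_add, map_sum, ← Finset.sum_neg_distrib]
  refine Finset.sum_congr rfl fun r _ => ?_
  rw [map_smul, Fin.val_succ, pow_succ, mul_neg_one, neg_smul, map_sum, Fin.sum_univ_succ,
    if_neg (by simp), zero_add]
  refine congrArg Neg.neg (congrArg _ (Finset.sum_congr rfl fun i _ => ?_))
  simp only [Fin.val_succ, Nat.add_le_add_iff_right, ← Fin.succ_castSucc, Fin.succ_lt_succ_iff,
    Fin.cons_succ]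
  split_ifs
  · rw [cons_tens, Fin.cons_update]
    congr 2
    funext l
    refine Fin.cases ?_ (fun l => ?_) l <;> simp [Fin.removeNth]
  · rw [map_zero]

theorem skew_succ_cons (a : ℕ) (y : PolyField K n) (z : Chain K n m) :
    skew (a + 1) (cons y z) = cons y (skew a z) := by
  classical
  suffices h : (skew (a + 1)) ∘ₗ (cons y : Chain K n m →ₗ[K] _) = cons y ∘ₗ skew a
    from congrArg (fun F => F z) h
  refine hom_ext_tens fun u => ?_
  rw [LinearMap.comp_apply, LinearMap.comp_apply, cons_tens, skew_tens, skew_tens, map_sum]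
  -- `decomposeFin` splits a permutation into the image of slot 0 and a permutation of the remaining
  -- slots; only the permutations fixing slot 0 contribute.
  rw [← Equiv.sum_comp Equiv.Perm.decomposeFin.symm, Fintype.sum_prod_type, Finset.sum_eq_single 0]
  · refine Finset.sum_congr rfl fun σ _ => ?_
    have hiff : (∀ i : Fin (m + 1), (i : ℕ) < a + 1 → Equiv.Perm.decomposeFin.symm (0, σ) i = i)
        ↔ ∀ i : Fin m, (i : ℕ) < a → σ i = i := by
      constructor
      · intro h i hi
        have := h i.succ (by simpa using hi)
        simpa using this
      · intro h i hi
        induction i using Fin.cases with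
        | zero => simp
        | succ i => simpa using h i (by simpa using hi)
    simp only [hiff]
    split_ifs
    · rw [map_smul, cons_tens, Equiv.Perm.decomposeFin.symm_sign, if_pos rfl, one_mul]
      congr 2
      funext l
      refine Fin.cases ?_ (fun l => ?_) l <;> simp
    · rw [map_zero]
  · intro p _ hp
    refine Finset.sum_eq_zero fun σ _ => if_neg fun h => hp ?_
    have := h 0 (by simp)
    simpa using this
  · exact fun h => absurd (Finset.mem_univ _) h

theorem tens_eq_cons (u : Fin (m + 1) → PolyField K n) :
    tens K n (m + 1) u = cons (u 0) (tens K n m (Fin.tail u)) := by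
  rw [cons_tens, Fin.cons_self_tail]

/-- A functional of the antisymmetrized tensor product is an alternating form. -/
noncomputable def skewForm (F : Chain K n m →ₗ[K] K) : PolyField K n [⋀^Fin m]→ₗ[K] K :=
  MultilinearMap.alternatization (F.compMultilinearMap (tens K n m))

theorem skewForm_apply (F : Chain K n m →ₗ[K] K) (u : Fin m → PolyField K n) :
    skewForm F u = F (skew 0 (tens K n m u)) := by
  rw [skewForm, MultilinearMap.alternatization_apply, skew_tens, map_sum]
  refine Finset.sum_congr rfl fun σ _ => ?_
  rw [if_pos (by simp), map_smul, Units.smul_def, zsmul_eq_mul, smul_eq_mul]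
  rfl

theorem hat_skewForm (F : Chain K n m →ₗ[K] K) (z : Chain K n m) :
    hat (skewForm F).toMultilinearMap z = F (skew 0 z) := by
  suffices h : hat (skewForm F).toMultilinearMap = F ∘ₗ skew 0 from congrArg (fun G => G z) h
  refine hom_ext_tens fun u => ?_
  rw [hat_tens, LinearMap.comp_apply, ← skewForm_apply]
  rfl

/-- Testing against a functional `F` reduces this to d² = 0 for the alternating form `skewForm F`;
the inner `skew` contributes only the factor `N`. -/
theorem skew_boundary_skew_boundary_zero [CharZero K] (z : Chain K n (m + 2)) :
    skew 0 (boundary 0 (skew 0 (boundary 0 z))) = 0 := by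
  rw [← Module.forall_dual_apply_eq_zero_iff K]
  intro F
  obtain ⟨N, -, hN⟩ := exists_hat_skew (K := K) (n := n) 0 (m + 1)
  rw [← hat_skewForm, ← hat_ceAlg, hN, ← hat_ceAlg, ceAlg_ceAlg]
  simp [hat_apply]

theorem skew_boundary_skew_boundary [CharZero K] (a : ℕ) (z : Chain K n (m + 2)) :
    skew a (boundary a (skew a (boundary a z))) = 0 := by
  induction a generalizing m with
  | zero => exact skew_boundary_skew_boundary_zero z
  | succ a ih =>
    suffices h : skew (a + 1) ∘ₗ boundary (a + 1) ∘ₗ skew (a + 1) ∘ₗ boundary (a + 1)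
        = (0 : Chain K n (m + 2) →ₗ[K] _) from congrArg (fun F => F z) h
    refine hom_ext_tens fun u => ?_
    simp only [LinearMap.comp_apply]
    cases m with
    | zero => simp [boundary_eq_zero]
    | succ m =>
      rw [tens_eq_cons, boundary_succ_cons, map_neg, skew_succ_cons, map_neg, boundary_succ_cons,
        neg_neg, skew_succ_cons, ih, map_zero]
      rfl

end Chain

/-! ### The filtration by order and the Euler field -/

namespace PolyField

open MvPolynomial

variable {K : Type*} [Field K] {n : ℕ}

/-- The polynomial vector fields without terms of degree less than `e`. -/
def vanishing (K : Type*) [Field K] (n e : ℕ) : Submodule K (PolyField K n) where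
  carrier := {u | ∀ (p : Fin n) (m : Fin n →₀ ℕ), m.degree < e → coeff m (u (X p)) = 0}
  add_mem' := by
    intro u v hu hv p m hm
    rw [Derivation.add_apply, coeff_add, hu p m hm, hv p m hm, add_zero]
  zero_mem' := by
    intro p m _
    simp
  smul_mem' := by
    intro c u hu p m hm
    rw [Derivation.smul_apply, coeff_smul, hu p m hm, smul_zero]

theorem vanishing_anti {d e : ℕ} (h : d ≤ e) : vanishing K n e ≤ vanishing K n d :=
  fun _ hu p m hm => hu p m (lt_of_lt_of_le hm h)

theorem monoField_mem_vanishing {e : ℕ} {α : Fin n →₀ ℕ} (h : e ≤ α.degree) (a : Fin n) :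
    Chain.monoField K α a ∈ vanishing K n e := by
  classical
  intro p m hm
  rw [Chain.monoField_X]
  split_ifs
  · rw [coeff_monomial, if_neg]
    rintro rfl
    exact absurd hm (not_lt.2 h)
  · simp

/-- The Euler field `∑ x_a ∂_a`. -/
noncomputable def euler (K : Type*) [Field K] (n : ℕ) : PolyField K n := mkDerivation K X

theorem euler_X (a : Fin n) : euler K n (X a) = X a := mkDerivation_X _ _ _

theorem euler_apply_of_isHomogeneous {g : MvPolynomial (Fin n) K} {k : ℕ} (hg : g.IsHomogeneous k) :
    euler K n g = (k : K) • g := by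
  rw [← Chain.sum_pderiv]
  simp only [euler_X]
  rw [hg.sum_X_mul_pderiv, nsmul_eq_mul, smul_eq_C_mul, map_natCast]

theorem euler_lie_monoField (α : Fin n →₀ ℕ) (a : Fin n) :
    ⁅euler K n, Chain.monoField K α a⁆ = ((α.degree : K) - 1) • Chain.monoField K α a := by
  refine derivation_ext fun b => ?_
  rw [Derivation.commutator_apply, euler_X, Derivation.smul_apply, Chain.monoField_X]
  split_ifs
  · rw [euler_apply_of_isHomogeneous (isHomogeneous_monomial 1 rfl), sub_smul, one_smul]
  · simp

end PolyField

/-! ### Forms vanish on cycles of high order and nonzero weight -/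

namespace Chain

open MvPolynomial SlotPoly LieCohomology

variable {K : Type*} [Field K] {n m : ℕ}

section Membership

theorem boundary_mem {a : ℕ} {z : Chain K n (m + 1)} {p : Fin m → Fin n}
    {S : Submodule K (MvPolynomial (Fin m × Fin n) K)}
    (h : ∀ r : Fin (m + 1), ∀ i : Fin m, a ≤ (i : ℕ) → i.castSucc < r → ∀ b : Fin n, ∀ l q,
      slotMap (r.insertNth i id : Fin (m + 1) → Fin m) (pderiv (l, b) (z q)) ∈ S) :
    boundary a z p ∈ S := by
  simp only [boundary, LinearMap.sum_apply, LinearMap.smul_apply, Finset.sum_apply, Pi.smul_apply]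
  refine Submodule.sum_mem _ fun r _ => Submodule.smul_mem _ _ (Submodule.sum_mem _ fun i _ => ?_)
  split_ifs with hi
  · rw [bracket_apply]
    refine Submodule.sum_mem _ fun b _ => ?_
    rw [map_sub]
    exact Submodule.sub_mem _ (h r i hi.1 hi.2 _ _ _) (h r i hi.1 hi.2 _ _ _)
  · exact Submodule.zero_mem _

theorem skew_mem {a : ℕ} {z : Chain K n m} {p : Fin m → Fin n}
    {S : Submodule K (MvPolynomial (Fin m × Fin n) K)}
    (h : ∀ σ : Equiv.Perm (Fin m), (∀ i : Fin m, (i : ℕ) < a → σ i = i) → ∀ q,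
      slotMap ⇑σ⁻¹ (z q) ∈ S) : skew a z p ∈ S := by
  simp only [skew, LinearMap.sum_apply, Finset.sum_apply]
  refine Submodule.sum_mem _ fun σ _ => ?_
  split_ifs with hσ
  · exact Submodule.smul_mem _ _ (h σ hσ _)
  · exact Submodule.zero_mem _

theorem boundary_mem_axesIdeal (a k : ℕ) {z : Chain K n (m + 1)}
    (hz : ∀ p, z p ∈ axesIdeal K n (m + 1) ^ (k + 1)) (p : Fin m → Fin n) :
    boundary a z p ∈ axesIdeal K n m ^ k :=
  boundary_mem (S := (axesIdeal K n m ^ k).restrictScalars K) fun _ _ _ _ _ _ q =>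
    slotMap_mem_axesIdeal_pow _ (prod_slotIdeal_insertNth _ _) k
      (derivation_mem_pow _ _ k (hz q))

theorem skew_mem_axesIdeal (a k : ℕ) {z : Chain K n m}
    (hz : ∀ p, z p ∈ axesIdeal K n m ^ k) (p : Fin m → Fin n) :
    skew a z p ∈ axesIdeal K n m ^ k :=
  skew_mem (S := (axesIdeal K n m ^ k).restrictScalars K) fun _ _ q =>
    slotMap_mem_axesIdeal_pow _ (prod_slotIdeal_perm _).le k (hz q)

/-- The derivative in a bracket costs one order. The omitted slot `r` satisfies `r > i ≥ a`, so the
inert slots keep their positions. -/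
theorem boundary_mem_diagPow (a s : ℕ) {z : Chain K n (m + 1)}
    (hz : ∀ p, z p ∈ diagPow K n a (m + 1) (s + 1)) (p : Fin m → Fin n) :
    boundary a z p ∈ diagPow K n a m s := by
  refine boundary_mem (S := (diagPow K n a m s).restrictScalars K) fun r i hi hir b l q => ?_
  refine mem_diagPow.2 fun x hx y hxy => ?_
  have h := slotMap_mem_diagIdeal_pow (r.insertNth i id : Fin (m + 1) → Fin m) (r.succAbove x)
    (r.succAbove y) s (derivation_mem_pow (pderiv (l, b)) _ s (mem_diagPow.1 (hz q) (r.succAbove x)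
      ?_ (r.succAbove y) fun h => hxy (Fin.succAbove_right_injective h)))
  · simpa only [Fin.insertNth_apply_succAbove, id] using h
  · rw [Fin.succAbove_of_castSucc_lt]
    · exact hx
    · rw [Fin.lt_def] at hir ⊢
      simp only [Fin.val_castSucc] at hir ⊢
      omega

theorem skew_mem_diagPow (a s : ℕ) {z : Chain K n m}
    (hz : ∀ p, z p ∈ diagPow K n a m s) (p : Fin m → Fin n) :
    skew a z p ∈ diagPow K n a m s := by
  refine skew_mem (S := (diagPow K n a m s).restrictScalars K) fun σ hσ q => ?_
  refine mem_diagPow.2 fun x hx y hxy => ?_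
  have h := slotMap_mem_diagIdeal_pow ⇑σ⁻¹ x (σ y) s (mem_diagPow.1 (hz q) x hx (σ y)
    fun h => hxy (σ.injective (h.trans (hσ x hx).symm)))
  have h1 : σ⁻¹ x = x := by rw [Equiv.Perm.inv_eq_iff_eq, hσ x hx]
  have h2 : σ⁻¹ (σ y) = y := σ.symm_apply_apply y
  simpa only [h1, h2] using h

/-- Order two on a diagonal leaves order one after the derivative in the bracket, and identifying
the two slots then gives zero. Hence all brackets involving one of the first `a` slots drop out. -/
theorem boundary_zero_eq_boundary (a : ℕ) {z : Chain K n (m + 1)}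
    (hz : ∀ p, z p ∈ diagPow K n a (m + 1) 2) : boundary 0 z = boundary a z := by
  simp only [boundary, LinearMap.sum_apply, LinearMap.smul_apply]
  refine Finset.sum_congr rfl fun r _ => congrArg _ (Finset.sum_congr rfl fun i _ => ?_)
  by_cases hir : i.castSucc < r
  · by_cases hi : a ≤ (i : ℕ)
    · rw [if_pos ⟨Nat.zero_le _, hir⟩, if_pos ⟨hi, hir⟩]
    · rw [if_pos ⟨Nat.zero_le _, hir⟩, if_neg fun h => hi h.1]
      have key : ∀ l b q, slotMap (r.insertNth i id : Fin (m + 1) → Fin m)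
          (pderiv (l, b) (z q)) = 0 := by
        intro l b q
        have h := slotMap_mem_diagIdeal_pow (r.insertNth i id : Fin (m + 1) → Fin m)
          i.castSucc r 1 (derivation_mem_pow (pderiv (l, b)) _ 1 (mem_diagPow.1 (hz q) i.castSucc
            (by simpa using hi) r hir.ne'))
        rwa [Fin.insertNth_apply_same, ← Fin.succAbove_of_castSucc_lt _ _ hir,
          Fin.insertNth_apply_succAbove, id, diagIdeal_self, pow_one, Ideal.mem_bot] at h
      funext p
      rw [bracket_apply]
      refine Finset.sum_eq_zero fun b _ => ?_
      rw [map_sub, key, key, sub_zero]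
  · rw [if_neg fun h => hir h.2, if_neg fun h => hir h.2]

theorem boundary_isHomogeneous (a k : ℕ) {z : Chain K n (m + 1)}
    (hz : ∀ p, (z p).IsHomogeneous (k + 1)) (p : Fin m → Fin n) :
    (boundary a z p).IsHomogeneous k :=
  boundary_mem (S := homogeneousSubmodule _ K k) fun _ _ _ _ _ _ q =>
    (hz q).pderiv.rename_isHomogeneous

theorem skew_isHomogeneous (a k : ℕ) {z : Chain K n m}
    (hz : ∀ p, (z p).IsHomogeneous k) (p : Fin m → Fin n) :
    (skew a z p).IsHomogeneous k :=
  skew_mem (S := homogeneousSubmodule _ K k) fun _ _ q => (hz q).rename_isHomogeneous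

end Membership

theorem hat_cons (f : PolyField K n [⋀^Fin (m + 1)]→ₗ[K] K) (y : PolyField K n)
    (z : Chain K n m) :
    hat f.toMultilinearMap (cons y z) = hat (f.curryLeft y).toMultilinearMap z := by
  suffices h : hat f.toMultilinearMap ∘ₗ cons y = hat (f.curryLeft y).toMultilinearMap from
    congrArg (fun F => F z) h
  refine hom_ext_tens fun u => ?_
  rw [LinearMap.comp_apply, cons_tens, hat_tens, hat_tens]
  rfl

theorem degree_curry (α : Fin m × Fin n →₀ ℕ) (i : Fin m) :
    (α.curry i).degree = ∑ a, α (i, a) := by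
  rw [Finsupp.degree_eq_sum]
  rfl

theorem slotFields_mem_vanishing {e B : ℕ} (hB : e ≤ B) {g : MvPolynomial (Fin m × Fin n) K}
    (hg : g ∈ axesIdeal K n m ^ B) {α : Fin m × Fin n →₀ ℕ} (hα : α ∈ g.support)
    (p : Fin m → Fin n) (i : Fin m) : slotFields K α p i ∈ PolyField.vanishing K n e := by
  refine PolyField.monoField_mem_vanishing ?_ _
  rw [degree_curry]
  by_contra h
  exact mem_support_iff.1 hα
    (slotDegree_of_mem_slotIdeal_pow i B (axesIdeal_pow_le i B hg) α (by omega))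

/-- E acts on x^α ∂_a by |α| - 1. Over the `m` slots these eigenvalues add up to `k - m`, and
passing to the dual changes the sign. -/
theorem hat_lieDer_euler (f : PolyField K n [⋀^Fin m]→ₗ[K] K) {k : ℕ} {z : Chain K n m}
    (hz : ∀ p, (z p).IsHomogeneous k) :
    hat (lieDer (PolyField.euler K n) f).toMultilinearMap z
      = -((k : K) - m) * hat f.toMultilinearMap z := by
  refine hat_eq_mul_hat _ _ _ _ fun p α hα => ?_
  change lieDer _ f _ = _ * f _
  have hk : (∑ i, ((α.curry i).degree : K)) = k := by
    have h : α.degree = k := by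
      rw [Finsupp.degree_eq_weight_one]
      exact hz p (mem_support_iff.1 hα)
    rw [← h, ← Nat.cast_sum]
    simp only [degree_curry]
    rw [Finsupp.degree_eq_sum, Fintype.sum_prod_type]
  have he : ∀ i, ⁅PolyField.euler K n, slotFields K α p i⁆
      = (((α.curry i).degree : K) - 1) • slotFields K α p i :=
    fun i => PolyField.euler_lie_monoField _ _
  rw [lieDer_apply]
  simp only [he, AlternatingMap.map_update_smul, Function.update_eq_self]
  rw [← Finset.sum_smul, Finset.sum_sub_distrib, hk]
  simp
  ring

/-- Tensoring with a homogeneous field of degree one splits chains vanishing on axes and diagonals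
into a part vanishing on the axes and a part vanishing on more diagonals. -/
theorem exists_cons_eq_add (B s a q : ℕ) : ∃ A, ∀ (k : ℕ) (z : Chain K n q),
    (∀ p, (z p).IsHomogeneous k) → (∀ p, z p ∈ axesIdeal K n q ^ A) →
    (∀ p, z p ∈ diagPow K n a q s) →
    ∃ h r : Chain K n (q + 1), cons (PolyField.euler K n) z = h + r ∧
      (∀ p, (r p).IsHomogeneous (k + 1)) ∧ (∀ p, h p ∈ axesIdeal K n (q + 1) ^ B) ∧
      ∀ p, r p ∈ diagPow K n (a + 1) (q + 1) s := by
  obtain ⟨A, hA⟩ := slotMap_succ_mem_sup (K := K) (n := n) B s a q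
  refine ⟨A, fun k z hk hM hD => ?_⟩
  choose h hh r hr _ hrk hadd using fun p => exists_isHomogeneous_add
    (containsComponents_axesIdeal_pow (K := K) (n := n) (m := q + 1) B)
    (containsComponents_diagPow (K := K) (n := n) (m := q + 1) (a + 1) s)
    ((hk p).rename_isHomogeneous (f := Prod.map Fin.succ id)) (hA _ ⟨hM p, hD p⟩)
  refine ⟨fun p => X (0, p 0) * h (p ∘ Fin.succ), fun p => X (0, p 0) * r (p ∘ Fin.succ), ?_, ?_,
    fun p => Ideal.mul_mem_left _ _ (hh _), fun p => Ideal.mul_mem_left _ _ (hr _)⟩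
  · funext p
    rw [cons_apply, PolyField.euler_X, rename_X, Pi.add_apply, ← mul_add, ← hadd]
  · intro p
    rw [add_comm k 1]
    exact (isHomogeneous_X _ _).mul (hrk _)

/-- Cartan's formula for E evaluated at `z`. The term d(ι_E f) vanishes because `z` is a cycle; in
df(E ⊗ z) = df(h) + df(r) the first term vanishes by the order of `h`, and the second loses all
brackets with inert slots. -/
theorem mul_hat_eq_hat_boundary [CharZero K] {q a e k : ℕ}
    (f : PolyField K n [⋀^Fin (q + 1)]→ₗ[K] K)
    (hf : ∀ u, (∀ i, u i ∈ PolyField.vanishing K n e) → ceAlg K (PolyField K n) (q + 1) f u = 0)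
    {z : Chain K n (q + 1)} {h r : Chain K n (q + 2)} (hz : ∀ p, (z p).IsHomogeneous k)
    (hzD : ∀ p, z p ∈ diagPow K n a (q + 1) 2) (hzb : skew a (boundary a z) = 0)
    (hadd : cons (PolyField.euler K n) z = h + r)
    (hh : ∀ p, h p ∈ axesIdeal K n (q + 2) ^ e) (hr : ∀ p, r p ∈ diagPow K n (a + 1) (q + 2) 2) :
    -((k : K) - (q + 1 : ℕ)) * hat f.toMultilinearMap z
      = hat f.toMultilinearMap (boundary (a + 1) r) := by
  have h1 : hat (ceAlg K (PolyField K n) (q + 1) f).toMultilinearMap h = 0 :=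
    hat_eq_zero _ _ fun p α hα => hf _ fun i => slotFields_mem_vanishing le_rfl (hh p) hα p i
  have h2 : hat (ceAlg K (PolyField K n) (q + 1) f).toMultilinearMap
      (cons (PolyField.euler K n) z) = hat f.toMultilinearMap (boundary (a + 1) r) := by
    rw [hadd, map_add, h1, zero_add, hat_ceAlg, boundary_zero_eq_boundary _ hr]
  -- The cycle condition concerns only the antisymmetrized boundary with `a` inert slots. Order two
  -- on the diagonals replaces `boundary 0` by `boundary a`, and antisymmetrizing costs the nonzero
  -- factor `N`.
  obtain ⟨N, hN, hNs⟩ := exists_hat_skew (K := K) (n := n) a q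
  have h3 : hat (ceAlg K (PolyField K n) q
      (f.curryLeft (PolyField.euler K n))).toMultilinearMap z = 0 := by
    rw [hat_ceAlg, boundary_zero_eq_boundary _ hzD]
    have := hNs (f.curryLeft (PolyField.euler K n)) (boundary a z)
    rw [hzb, map_zero] at this
    exact (mul_eq_zero.1 this.symm).resolve_left hN
  have h4 : ∀ (g g' : PolyField K n [⋀^Fin (q + 1)]→ₗ[K] K),
      hat (g - g').toMultilinearMap z = hat g.toMultilinearMap z - hat g'.toMultilinearMap z := by
    intro g g'
    simp [hat_apply, mul_sub]
  rw [← hat_lieDer_euler f hz, ← h2, hat_cons, curryLeft_ceAlg, h4, h3, sub_zero]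

/-- A form whose differential vanishes on fields of high order kills cycles of weight different from
the degree that vanish to high order on the axes and on the first diagonals. -/
theorem hat_eq_zero_of_cycle [CharZero K] (q t : ℕ) : ∀ a, q ≤ a + t → ∀ e, ∃ A s,
    ∀ f : PolyField K n [⋀^Fin (q + 1)]→ₗ[K] K,
    (∀ u, (∀ i, u i ∈ PolyField.vanishing K n e) → ceAlg K (PolyField K n) (q + 1) f u = 0) →
    ∀ k, k ≠ q + 1 → ∀ z : Chain K n (q + 1), (∀ p, (z p).IsHomogeneous k) →
    (∀ p, z p ∈ axesIdeal K n (q + 1) ^ A) → (∀ p, z p ∈ diagPow K n a (q + 1) s) →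
    skew a (boundary a z) = 0 → hat f.toMultilinearMap z = 0 := by
  have mono : ∀ {a m s s' : ℕ}, s ≤ s' → diagPow K n a m s' ≤ diagPow K n a m s :=
    fun h x hx => mem_diagPow.2 fun i hi j hj => Ideal.pow_le_pow_right h (mem_diagPow.1 hx i hi j hj)
  have fin : ∀ {k : ℕ}, k ≠ q + 1 → ∀ {x : K}, -((k : K) - (q + 1 : ℕ)) * x = 0 → x = 0 := by
    intro k hk x h
    refine (mul_eq_zero.1 h).resolve_left fun h => hk ?_
    exact_mod_cast sub_eq_zero.1 (neg_eq_zero.1 h)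
  induction t with
  | zero =>
    intro a ha e
    obtain ⟨A, hA⟩ := exists_cons_eq_add (K := K) (n := n) e 2 a (q + 1)
    refine ⟨A, 2, fun f hf k hk z hz hM hD hzb => fin hk ?_⟩
    obtain ⟨h, r, hadd, -, hh, hr⟩ := hA k z hz hM hD
    -- Of the `q + 2` slots of `r` at least `q + 1` are inert, so no two active slots are left to be
    -- bracketed.
    rw [mul_hat_eq_hat_boundary f hf hz hD hzb hadd hh hr, boundary_eq_zero (by omega)]
    simp
  | succ t ih =>
    intro a ha e
    obtain ⟨A₂, s₂, h₂⟩ := ih (a + 1) (by omega) e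
    -- The `+ 1`s pay for the derivative in the next boundary; `e` gives df(h) = 0, and `2` removes
    -- the brackets with inert slots.
    obtain ⟨A, hA⟩ := exists_cons_eq_add (K := K) (n := n) (max (A₂ + 1) e) (max (s₂ + 1) 2) a (q + 1)
    refine ⟨A, max (s₂ + 1) 2, fun f hf k hk z hz hM hD hzb => fin hk ?_⟩
    obtain ⟨h, r, hadd, hrk, hh, hr⟩ := hA k z hz hM hD
    rw [mul_hat_eq_hat_boundary f hf hz (fun p => mono (le_max_right _ _) (hD p)) hzb hadd
      (fun p => Ideal.pow_le_pow_right (le_max_right _ _) (hh p))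
      (fun p => mono (le_max_right _ _) (hr p))]
    -- The antisymmetrized boundary of E ⊗ z is zero. Hence a chain coming from `r`, with high order
    -- on the diagonals, equals up to sign one coming from `h`, with high order on the axes; it has
    -- both properties required by the induction hypothesis.
    have hT : skew (a + 1) (boundary (a + 1) r) = -skew (a + 1) (boundary (a + 1) h) := by
      rw [eq_neg_iff_add_eq_zero, ← map_add, ← map_add, add_comm r, ← hadd, boundary_succ_cons,
        map_neg, skew_succ_cons, hzb, map_zero, neg_zero]
    obtain ⟨N, hN, hNs⟩ := exists_hat_skew (K := K) (n := n) (a + 1) (q + 1)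
    have h3 := h₂ f hf k hk (skew (a + 1) (boundary (a + 1) r))
      (skew_isHomogeneous _ _ (boundary_isHomogeneous _ _ hrk))
      (fun p => by
        rw [hT]
        exact neg_mem (skew_mem_axesIdeal _ _ (boundary_mem_axesIdeal _ _ fun p =>
          Ideal.pow_le_pow_right (le_max_left _ _) (hh p)) p))
      (skew_mem_diagPow _ _ (boundary_mem_diagPow _ _ fun p => mono (le_max_left _ _) (hr p)))
      (skew_boundary_skew_boundary _ _)
    rw [hNs] at h3
    exact (mul_eq_zero.1 h3).resolve_left hN

end Chain

/-! ### Truncation by degree and primitives on fields of high order -/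

namespace Chain

open MvPolynomial SlotPoly LieCohomology

variable {K : Type*} [Field K] {n m : ℕ}

/-- The homogeneous component of degree `k` of a chain. -/
noncomputable def homComponent (K : Type*) [Field K] (n m k : ℕ) : Chain K n m →ₗ[K] Chain K n m :=
  LinearMap.pi fun p => homogeneousComponent k ∘ₗ LinearMap.proj p

theorem homComponent_apply (k : ℕ) (z : Chain K n m) (p : Fin m → Fin n) :
    homComponent K n m k z p = homogeneousComponent k (z p) := rfl

theorem homComponent_of_isHomogeneous {j : ℕ} (k : ℕ) {z : Chain K n m}
    (hz : ∀ p, (z p).IsHomogeneous j) : homComponent K n m k z = if k = j then z else 0 := by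
  funext p
  rw [homComponent_apply, homogeneousComponent_of_mem (hz p)]
  split_ifs <;> rfl

/-- The part of degree less than `T` of a chain. -/
noncomputable def truncate (K : Type*) [Field K] (n m T : ℕ) : Chain K n m →ₗ[K] Chain K n m :=
  ∑ k ∈ Finset.range T, homComponent K n m k

theorem exists_truncate_eq (z : Chain K n m) : ∃ T, truncate K n m T z = z := by
  refine ⟨(Finset.univ.sup fun p => (z p).totalDegree) + 1, funext fun p => ?_⟩
  conv_rhs => rw [← sum_homogeneousComponent (z p)]
  rw [truncate, LinearMap.sum_apply, Finset.sum_apply]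
  refine (Finset.sum_subset (Finset.range_mono (Nat.add_le_add_right
    (Finset.le_sup (f := fun p => (z p).totalDegree) (Finset.mem_univ p)) 1)) ?_).symm
  intro k _ hk
  exact homogeneousComponent_eq_zero _ _ (by simpa using hk)

theorem hom_ext_isHomogeneous {W : Type*} [AddCommGroup W] [Module K W] {F G : Chain K n m →ₗ[K] W}
    (h : ∀ k, ∀ z : Chain K n m, (∀ p, (z p).IsHomogeneous k) → F z = G z) : F = G := by
  refine LinearMap.ext fun z => ?_
  obtain ⟨T, hT⟩ := exists_truncate_eq z
  rw [← hT, truncate, LinearMap.sum_apply, map_sum, map_sum]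
  exact Finset.sum_congr rfl fun k _ => h k _ fun p => homogeneousComponent_isHomogeneous _ _

/-- The antisymmetrized boundary. -/
noncomputable def skewBoundary (K : Type*) [Field K] (n m : ℕ) :
    Chain K n (m + 1) →ₗ[K] Chain K n m :=
  skew 0 ∘ₗ boundary 0

theorem skewBoundary_of_isHomogeneous_zero {z : Chain K n (m + 1)}
    (hz : ∀ p, (z p).IsHomogeneous 0) : skewBoundary K n m z = 0 := by
  have h : boundary 0 z = 0 := by
    funext p
    refine (Submodule.mem_bot K).1 (boundary_mem fun r i _ _ b l q => ?_)
    have : pderiv (l, b) (z q) = 0 := by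
      ext d
      rw [coeff_pderiv, (hz q).coeff_eq_zero, zero_mul, coeff_zero]
      simp
    rw [this, map_zero]
    exact Submodule.zero_mem _
  rw [skewBoundary, LinearMap.comp_apply, h, map_zero]

/-- Each bracket contains exactly one derivative, so the boundary lowers the degree by one. -/
theorem homComponent_skewBoundary (k : ℕ) (z : Chain K n (m + 1)) :
    homComponent K n m k (skewBoundary K n m z)
      = skewBoundary K n m (homComponent K n (m + 1) (k + 1) z) := by
  suffices h : homComponent K n m k ∘ₗ skewBoundary K n m
      = skewBoundary K n m ∘ₗ homComponent K n (m + 1) (k + 1) from congrArg (fun F => F z) h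
  refine hom_ext_isHomogeneous fun j z hz => ?_
  rw [LinearMap.comp_apply, LinearMap.comp_apply, homComponent_of_isHomogeneous _ hz]
  cases j with
  | zero => simp [skewBoundary_of_isHomogeneous_zero hz]
  | succ j =>
    rw [homComponent_of_isHomogeneous (j := j) _ (z := skewBoundary K n m z)
      (skew_isHomogeneous _ _ (boundary_isHomogeneous _ _ hz))]
    simp only [Nat.add_right_cancel_iff]
    split_ifs
    · rfl
    · rw [map_zero]

theorem truncate_skewBoundary (T : ℕ) (z : Chain K n (m + 1)) :
    truncate K n m T (skewBoundary K n m z) = skewBoundary K n m (truncate K n (m + 1) (T + 1) z) := by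
  rw [truncate, truncate, LinearMap.sum_apply, LinearMap.sum_apply, Finset.sum_range_succ', map_add,
    map_sum, skewBoundary_of_isHomogeneous_zero (z := homComponent K n (m + 1) 0 z)
      fun p => homogeneousComponent_isHomogeneous _ _, add_zero]
  exact Finset.sum_congr rfl fun k _ => homComponent_skewBoundary k z

theorem mem_vanishing_iff {e : ℕ} {u : PolyField K n} : u ∈ PolyField.vanishing K n e ↔
    ∀ p, u (X p) ∈ idealOfVars (Fin n) K ^ e := by
  simp only [mem_pow_idealOfVars_iff']
  rfl

theorem tens_mem_axesIdeal {e : ℕ} {u : Fin m → PolyField K n}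
    (hu : ∀ i, u i ∈ PolyField.vanishing K n e) (p : Fin m → Fin n) :
    tens K n m u p ∈ axesIdeal K n m ^ e := by
  rw [tens_apply, slotProd_apply, axesIdeal, ← Finset.prod_pow]
  refine Ideal.prod_mem_prod fun i _ => ?_
  have h := Ideal.mem_map_of_mem (rename (Prod.mk i) : _ →ₐ[K] MvPolynomial (Fin m × Fin n) K)
    (mem_vanishing_iff.1 (hu i) (p i))
  rw [Ideal.map_pow] at h
  refine Ideal.pow_right_mono ?_ e h
  rw [idealOfVars, Ideal.map_span, ← Set.range_comp, slotIdeal]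
  refine Ideal.span_mono ?_
  rintro _ ⟨a, rfl⟩
  exact ⟨a, by simp⟩

theorem homComponent_tens_eq_zero {e k : ℕ} (hk : k < e) {u : Fin m → PolyField K n} {i : Fin m}
    (hu : u i ∈ PolyField.vanishing K n e) : homComponent K n m k (tens K n m u) = 0 := by
  funext p
  rw [homComponent_apply]
  refine homogeneousComponent_eq_zero' _ _ fun d hd => ?_
  have h : tens K n m u p ∈ idealOfVars (Fin m × Fin n) K ^ e := by
    rw [tens_apply, slotProd_apply, ← Finset.mul_prod_erase _ _ (Finset.mem_univ i)]
    refine Ideal.mul_mem_right _ _ ?_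
    have h := Ideal.mem_map_of_mem (rename (Prod.mk i) : _ →ₐ[K] MvPolynomial (Fin m × Fin n) K)
      (mem_vanishing_iff.1 hu (p i))
    rw [Ideal.map_pow] at h
    refine Ideal.pow_right_mono ?_ e h
    rw [idealOfVars, Ideal.map_span, ← Set.range_comp, idealOfVars]
    refine Ideal.span_mono ?_
    rintro _ ⟨a, rfl⟩
    exact ⟨(i, a), by simp⟩
  have := (mem_pow_idealOfVars_iff e _).1 h d hd
  omega

theorem truncate_skew_tens_eq_zero {e : ℕ} {u : Fin m → PolyField K n} {i : Fin m}
    (hu : u i ∈ PolyField.vanishing K n e) : truncate K n m e (skew 0 (tens K n m u)) = 0 := by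
  rw [skew_tens, map_sum]
  refine Finset.sum_eq_zero fun σ _ => ?_
  rw [if_pos (by simp), map_smul, truncate, LinearMap.sum_apply, Finset.sum_eq_zero, smul_zero]
  intro k hk
  exact homComponent_tens_eq_zero (i := σ⁻¹ i) (Finset.mem_range.1 hk)
    (by rwa [show (u ∘ σ) (σ⁻¹ i) = u i from congrArg u (σ.apply_symm_apply i)])

theorem exists_factor {V W : Type*} [AddCommGroup V] [Module K V] [AddCommGroup W] [Module K W]
    (L : V →ₗ[K] W) (g : V →ₗ[K] K) (h : ∀ v, L v = 0 → g v = 0) :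
    ∃ b : W →ₗ[K] K, ∀ v, g v = b (L v) := by
  have hg : g ∈ LinearMap.range L.dualMap := by
    rw [LinearMap.range_dualMap_eq_dualAnnihilator_ker, Submodule.mem_dualAnnihilator]
    exact fun v hv => h v hv
  obtain ⟨b, rfl⟩ := hg
  exact ⟨b, fun v => rfl⟩

/-- A form is finite if it vanishes as soon as one argument vanishes to order `N`. -/
def KilledBy {k : ℕ} (f : PolyField K n [⋀^Fin k]→ₗ[K] K) (N : ℕ) : Prop :=
  ∀ u i, u i ∈ PolyField.vanishing K n N → f u = 0

/-- By pigeonhole, a monomial of degree at least `q * N` has degree at least `N` in some slot. A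
finite form therefore sees only finitely many degrees. -/
theorem hat_eq_zero_of_killedBy {q N k : ℕ} {f : PolyField K n [⋀^Fin q]→ₗ[K] K}
    (hf : KilledBy f N) (hk : q * N ≤ k) (hq : 0 < q) {z : Chain K n q}
    (hz : ∀ p, (z p).IsHomogeneous k) : hat f.toMultilinearMap z = 0 := by
  refine hat_eq_zero _ _ fun p α hα => ?_
  have h : α.degree = k := by
    rw [Finsupp.degree_eq_weight_one]
    exact hz p (mem_support_iff.1 hα)
  rw [Finsupp.degree_eq_sum, Fintype.sum_prod_type] at h
  obtain ⟨i, hi⟩ : ∃ i : Fin q, N ≤ ∑ a, α (i, a) := by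
    by_contra! hlt
    have : Nonempty (Fin q) := ⟨⟨0, hq⟩⟩
    have h1 := Finset.sum_lt_sum_of_nonempty (s := (Finset.univ : Finset (Fin q)))
      Finset.univ_nonempty fun i _ => hlt i
    rw [h, Finset.sum_const, Finset.card_univ, Fintype.card_fin, smul_eq_mul] at h1
    omega
  exact hf _ i (PolyField.monoField_mem_vanishing (by rwa [degree_curry]) _)

theorem hat_truncate {q N T : ℕ} {f : PolyField K n [⋀^Fin q]→ₗ[K] K} (hf : KilledBy f N)
    (hq : 0 < q) (hT : q * N ≤ T) (z : Chain K n q) :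
    hat f.toMultilinearMap (truncate K n q T z) = hat f.toMultilinearMap z := by
  suffices h : hat f.toMultilinearMap ∘ₗ truncate K n q T = hat f.toMultilinearMap
    from congrArg (fun F => F z) h
  refine hom_ext_isHomogeneous fun k z hz => ?_
  rw [LinearMap.comp_apply, truncate, LinearMap.sum_apply]
  simp only [homComponent_of_isHomogeneous _ hz, Finset.sum_ite_eq', Finset.mem_range]
  split_ifs with h
  · rfl
  · rw [map_zero, hat_eq_zero_of_killedBy hf (by omega) hq hz]

/-- A finite form that is closed on fields of high order is the differential of a finite form on
fields of high order. -/
theorem exists_primitive [CharZero K] (n q e : ℕ) : ∃ e', ∀ f : PolyField K n [⋀^Fin (q + 1)]→ₗ[K] K,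
    (∃ N, KilledBy f N) →
    (∀ u, (∀ i, u i ∈ PolyField.vanishing K n e) → ceAlg K (PolyField K n) (q + 1) f u = 0) →
    ∃ b : PolyField K n [⋀^Fin q]→ₗ[K] K, (∃ N, KilledBy b N) ∧
      ∀ u, (∀ i, u i ∈ PolyField.vanishing K n e') → f u = ceAlg K (PolyField K n) q b u := by
  obtain ⟨A₀, s, hA⟩ := hat_eq_zero_of_cycle (K := K) (n := n) q q 0 (by omega) e
  -- The bound `q + 2` excludes degree `q + 1`, that is, weight zero, about which
  -- `hat_eq_zero_of_cycle` says nothing.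
  set A := max A₀ (q + 2)
  refine ⟨A, fun f ⟨N, hN⟩ hf => ?_⟩
  let Y : Submodule K (Chain K n (q + 1)) :=
    { carrier := {z | ∀ p, z p ∈ axesIdeal K n (q + 1) ^ A}
      add_mem' := fun hx hy p => add_mem (hx p) (hy p)
      zero_mem' := fun p => zero_mem _
      smul_mem' := fun c x hx p => by
        rw [Pi.smul_apply, smul_eq_C_mul]
        exact Ideal.mul_mem_left _ _ (hx p) }
  have hYc : ∀ z ∈ Y, ∀ k, homComponent K n (q + 1) k z ∈ Y := fun z hz k p =>
    containsComponents_axesIdeal_pow A _ (hz p) k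
  have hY0 : ∀ z ∈ Y, homComponent K n (q + 1) (q + 1) z = 0 := by
    intro z hz
    funext p
    refine homogeneousComponent_eq_zero' _ _ fun d hd h => mem_support_iff.1 hd ?_
    refine slotDegree_of_mem_slotIdeal_pow 0 A (axesIdeal_pow_le 0 A (hz p)) d ?_
    rw [Finsupp.degree_eq_sum, Fintype.sum_prod_type, Fin.sum_univ_succ] at h
    have : q + 2 ≤ A := le_max_right _ _
    omega
  have hker : ∀ z ∈ Y, skewBoundary K n q z = 0 → hat f.toMultilinearMap z = 0 := by
    intro z hz hz0
    obtain ⟨T, hT⟩ := exists_truncate_eq z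
    rw [← hT, truncate, LinearMap.sum_apply, map_sum]
    refine Finset.sum_eq_zero fun k _ => ?_
    by_cases hk : k = q + 1
    · rw [hk, hY0 z hz, map_zero]
    · refine hA f hf k hk _ (fun p => homogeneousComponent_isHomogeneous _ _)
        (fun p => Ideal.pow_le_pow_right (le_max_left _ _) (hYc z hz k p))
        (fun p => mem_diagPow.2 fun i hi => absurd hi (Nat.not_lt_zero _)) ?_
      cases k with
      | zero =>
        exact skewBoundary_of_isHomogeneous_zero fun p => homogeneousComponent_isHomogeneous _ _
      | succ k =>
        have := homComponent_skewBoundary k z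
        rw [hz0, map_zero] at this
        exact this.symm
  -- Vanishing on the cycles in `Y`, the form factors there through the boundary. The functional `b`
  -- so obtained is arbitrary and need not be finite.
  obtain ⟨b, hb⟩ := exists_factor (skewBoundary K n q ∘ₗ Y.subtype)
    (hat f.toMultilinearMap ∘ₗ Y.subtype) fun v hv => hker v v.2 hv
  -- `f` sees no degree from `T` on, so cutting `b` off at `T` makes it finite without harm. The
  -- boundary lowers degrees by one, whence `T + 1` on its source.
  set T := (q + 1) * N
  refine ⟨skewForm (b ∘ₗ truncate K n q T), ⟨T, fun u i hu => ?_⟩, fun u hu => ?_⟩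
  · rw [skewForm_apply, LinearMap.comp_apply, truncate_skew_tens_eq_zero hu, map_zero]
  · have hz : tens K n (q + 1) u ∈ Y := tens_mem_axesIdeal hu
    generalize hzdef : tens K n (q + 1) u = z at hz
    have hz' : truncate K n (q + 1) (T + 1) z ∈ Y := by
      rw [truncate, LinearMap.sum_apply]
      exact Submodule.sum_mem _ fun k _ => hYc z hz k
    have h1 : hat f.toMultilinearMap z = hat f.toMultilinearMap (truncate K n (q + 1) (T + 1) z) :=
      (hat_truncate hN (Nat.succ_pos q) (Nat.le_succ T) z).symm
    have h2 : hat (ceAlg K (PolyField K n) q (skewForm (b ∘ₗ truncate K n q T))).toMultilinearMap z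
        = hat f.toMultilinearMap z := by
      rw [hat_ceAlg, hat_skewForm, h1]
      have := hb ⟨_, hz'⟩
      simp only [LinearMap.comp_apply, Submodule.subtype_apply] at this
      rw [this, ← truncate_skewBoundary]
      rfl
    rw [← hzdef, hat_tens, hat_tens] at h2
    exact h2.symm

end Chain

/-! ### Forms on a subalgebra enlarged by one vector -/

namespace LieCohomology

section Extension

variable {K L : Type*} [Field K] [LieRing L] [LieAlgebra K L]

theorem ceAlg_eq_zero_of_forall_mem {k : ℕ} {f : L [⋀^Fin k]→ₗ[K] K} {J : Submodule K L}
    (hJ : ∀ x ∈ J, ∀ y ∈ J, ⁅x, y⁆ ∈ J) (hf : ∀ u, (∀ i, u i ∈ J) → f u = 0)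
    {u : Fin (k + 1) → L} (hu : ∀ i, u i ∈ J) : ceAlg K L k f u = 0 := by
  rw [ceAlg_apply, ceFun]
  refine Finset.sum_eq_zero fun j _ => ?_
  rw [Finset.sum_eq_zero, mul_zero]
  intro i _
  split_ifs
  · refine hf _ fun l => ?_
    by_cases h : l = i
    · subst h
      rw [Function.update_self]
      exact hJ _ (hu _) _ (hu _)
    · rw [Function.update_of_ne h]
      exact hu _
  · rfl

/-- The exterior product of a linear form and an alternating form. -/
noncomputable def wedge {k : ℕ} (φ : L →ₗ[K] K) (a : L [⋀^Fin k]→ₗ[K] K) : L [⋀^Fin (k + 1)]→ₗ[K] K :=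
  AlternatingMap.alternatizeUncurryFin (φ.smulRight a)

theorem wedge_apply {k : ℕ} (φ : L →ₗ[K] K) (a : L [⋀^Fin k]→ₗ[K] K) (u : Fin (k + 1) → L) :
    wedge φ a u = ∑ i : Fin (k + 1), (-1) ^ (i : ℕ) * (φ (u i) * a (i.removeNth u)) := by
  rw [wedge, AlternatingMap.alternatizeUncurryFin_apply]
  simp

/-- On a subalgebra `J` killed by `φ`, contracting `d(φ ∧ a)` with a vector `ω` normalizing `J` such
that `φ ω = 1` gives `-d a`. -/
theorem ceAlg_wedge_vecCons {k : ℕ} {φ : L →ₗ[K] K} {a : L [⋀^Fin k]→ₗ[K] K} {J : Submodule K L}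
    (hJ : ∀ x ∈ J, ∀ y ∈ J, ⁅x, y⁆ ∈ J) {ω : L} (hω : ∀ x ∈ J, ⁅ω, x⁆ ∈ J) (hφω : φ ω = 1)
    (hφJ : ∀ x ∈ J, φ x = 0) {u : Fin (k + 1) → L} (hu : ∀ i, u i ∈ J) :
    ceAlg K L (k + 1) (wedge φ a) (Matrix.vecCons ω u) = -ceAlg K L k a u := by
  have hb : ∀ v : Fin (k + 1) → L, (∀ i, v i ∈ J) → wedge φ a v = 0 := by
    intro v hv
    rw [wedge_apply]
    exact Finset.sum_eq_zero fun i _ => by rw [hφJ _ (hv i), zero_mul, mul_zero]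
  have h1 : lieDer ω (wedge φ a) u = 0 := by
    rw [lieDer_apply, Finset.sum_eq_zero, neg_zero]
    intro i _
    refine hb _ fun l => ?_
    by_cases h : l = i
    · subst h
      rw [Function.update_self]
      exact hω _ (hu _)
    · rw [Function.update_of_ne h]
      exact hu _
  have h2 : ceAlg K L k ((wedge φ a).curryLeft ω - a) u = 0 := by
    refine ceAlg_eq_zero_of_forall_mem hJ (fun v hv => ?_) hu
    rw [AlternatingMap.sub_apply, AlternatingMap.curryLeft_apply_apply, wedge_apply,
      Fin.sum_univ_succ, Finset.sum_eq_zero, add_zero]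
    · simp only [Matrix.cons_val_zero, hφω, Fin.val_zero, pow_zero, one_mul]
      rw [sub_eq_zero]
      congr 1
    · intro i _
      rw [Matrix.cons_val_succ, hφJ _ (hv i), zero_mul, mul_zero]
  rw [map_sub, AlternatingMap.sub_apply, sub_eq_zero] at h2
  rw [ceAlg_apply, ceFun_vecCons, h1, ← ceAlg_apply, h2, zero_sub]

/-- Reduction of the entries of a tuple modulo `P`. -/
theorem eq_zero_of_sup {k : ℕ} {F : L [⋀^Fin k]→ₗ[K] K} {J P S : Submodule K L}
    (hSJ : S ≤ J) {i : Fin k} (hF : ∀ u, (∀ j, u j ∈ J) → u i ∈ S → F u = 0)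
    (hFP : ∀ u, (∀ j, u j ∈ J ⊔ P) → u i ∈ S → ∀ j ≠ i, ∀ y ∈ P, F (Function.update u j y) = 0)
    {u : Fin k → L} (hu : ∀ j, u j ∈ J ⊔ P) (hui : u i ∈ S) : F u = 0 := by
  classical
  suffices h : ∀ s : Finset (Fin k), ∀ u : Fin k → L, (∀ j, u j ∈ J ⊔ P) → u i ∈ S →
      (∀ j ∉ s, u j ∈ J) → F u = 0 from h Finset.univ u hu hui fun j hj => absurd (Finset.mem_univ j) hj
  intro s
  induction s using Finset.induction_on with
  | empty => exact fun u _ hui h => hF u (fun j => h j (Finset.notMem_empty j)) hui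
  | insert j s hj ih =>
    intro u hu hui h
    by_cases hij : j = i
    · refine ih u hu hui fun l hl => ?_
      by_cases hlj : l = j
      · rw [hlj, hij]
        exact hSJ hui
      · exact h l fun hm => (Finset.mem_insert.1 hm).elim hlj hl
    · obtain ⟨x, hx, y, hy, hxy⟩ := Submodule.mem_sup.1 (hu j)
      rw [← Function.update_eq_self j u, ← hxy, AlternatingMap.map_update_add,
        hFP u hu hui j hij y hy, add_zero]
      refine ih _ (fun l => ?_) ?_ fun l hl => ?_
      · by_cases hlj : l = j
        · subst hlj
          rw [Function.update_self]
          exact Submodule.mem_sup_left hx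
        · rw [Function.update_of_ne hlj]
          exact hu l
      · rwa [Function.update_of_ne (Ne.symm hij)]
      · by_cases hlj : l = j
        · subst hlj
          rwa [Function.update_self]
        · rw [Function.update_of_ne hlj]
          exact h l fun hm => (Finset.mem_insert.1 hm).elim hlj hl

/-- A form vanishing on tuples in `J` with an entry in `S`, whose contraction with `ω` does so too,
vanishes on tuples in `J ⊔ K ∙ ω` with an entry in `S`. -/
theorem eq_zero_of_sup_span_of_curryLeft {k : ℕ} {F : L [⋀^Fin (k + 1)]→ₗ[K] K}
    {J S : Submodule K L} {ω : L} (hSJ : S ≤ J)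
    (hF : ∀ u i, (∀ j, u j ∈ J) → u i ∈ S → F u = 0)
    (hFω : ∀ u i, (∀ j, u j ∈ J) → u i ∈ S → F (Matrix.vecCons ω u) = 0)
    {u : Fin (k + 1) → L} {i : Fin (k + 1)} (hu : ∀ j, u j ∈ J ⊔ K ∙ ω) (hui : u i ∈ S) :
    F u = 0 := by
  have h1 : ∀ (v : Fin k → L) (i : Fin k), (∀ j, v j ∈ J ⊔ K ∙ ω) → v i ∈ S →
      F.curryLeft ω v = 0 := by
    intro v i hv hvi
    refine eq_zero_of_sup hSJ (F := F.curryLeft ω) (fun v hv hvi => hFω v i hv hvi)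
      (fun v _ _ j _ y hy => ?_) hv hvi
    obtain ⟨c, rfl⟩ := Submodule.mem_span_singleton.1 hy
    rw [AlternatingMap.map_update_smul, smul_eq_zero]
    right
    exact F.map_eq_zero_of_eq (i := 0) (j := j.succ) _ (by simp) (Fin.succ_ne_zero j).symm
  refine eq_zero_of_sup hSJ (fun v hv hvi => hF v i hv hvi) (fun v hv hvi j hj y hy => ?_) hu hui
  obtain ⟨c, rfl⟩ := Submodule.mem_span_singleton.1 hy
  rw [AlternatingMap.map_update_smul, ← Fin.insertNth_removeNth, AlternatingMap.map_insertNth]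
  obtain ⟨l, rfl⟩ := Fin.exists_succAbove_eq hj.symm
  have := h1 (j.removeNth v) l (fun x => hv _) hvi
  rw [AlternatingMap.curryLeft_apply_apply] at this
  rw [this, smul_zero, smul_zero]

end Extension

end LieCohomology

/-! ### Descent through the filtration by order -/

namespace PolyField

open MvPolynomial LieCohomology Chain

variable {K : Type*} [Field K] {n : ℕ}

theorem lie_mem_vanishing {a b : ℕ} {u v : PolyField K n} (hu : u ∈ vanishing K n a)
    (hv : v ∈ vanishing K n b) : ⁅u, v⁆ ∈ vanishing K n (a + b - 1) := by
  have key : ∀ {a b : ℕ} {v : PolyField K n} {g : MvPolynomial (Fin n) K}, v ∈ vanishing K n b →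
      g ∈ idealOfVars (Fin n) K ^ a → v g ∈ idealOfVars (Fin n) K ^ (a + b - 1) := by
    intro a b v g hv hg
    rw [← sum_pderiv]
    refine sum_mem fun i _ => ?_
    have h1 := mem_vanishing_iff.1 hv i
    have h2 : pderiv i g ∈ idealOfVars (Fin n) K ^ (a - 1) := by
      cases a with
      | zero => simp
      | succ a => exact SlotPoly.derivation_mem_pow _ _ a hg
    have h3 := Ideal.mul_mem_mul h1 h2
    rw [← pow_add] at h3
    exact Ideal.pow_le_pow_right (by omega) h3
  rw [mem_vanishing_iff]
  intro p
  rw [Derivation.commutator_apply]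
  refine sub_mem ?_ (key hv (mem_vanishing_iff.1 hu p))
  rw [add_comm]
  exact key hu (mem_vanishing_iff.1 hv p)

theorem vanishing_zero : vanishing K n 0 = ⊤ :=
  eq_top_iff.2 fun _ _ _ _ h => absurd h (Nat.not_lt_zero _)

theorem lie_mem_vanishing_left (u : PolyField K n) {b : ℕ} {v : PolyField K n}
    (hv : v ∈ vanishing K n (b + 1)) : ⁅u, v⁆ ∈ vanishing K n b := by
  have h := lie_mem_vanishing (a := 0) (u := u) (by rw [vanishing_zero]; trivial) hv
  simpa using h

theorem lie_mem_vanishing_right (u : PolyField K n) {b : ℕ} {v : PolyField K n}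
    (hv : v ∈ vanishing K n (b + 1)) : ⁅v, u⁆ ∈ vanishing K n b := by
  rw [← lie_skew]
  exact neg_mem (lie_mem_vanishing_left u hv)

/-- `f` vanishes on tuples in `J` with an entry of order at least `N`. -/
def KilledOn {k : ℕ} (J : Submodule K (PolyField K n)) (f : PolyField K n [⋀^Fin k]→ₗ[K] K) (N : ℕ) :
    Prop :=
  ∀ u i, (∀ j, u j ∈ J) → u i ∈ vanishing K n N → f u = 0

theorem killedBy_mono {k N N' : ℕ} (h : N ≤ N') {f : PolyField K n [⋀^Fin k]→ₗ[K] K}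
    (hf : KilledBy f N) : KilledBy f N' := fun u i hu => hf u i (vanishing_anti h hu)

theorem killedBy_sub {k N N' : ℕ} {f g : PolyField K n [⋀^Fin k]→ₗ[K] K}
    (hf : KilledBy f N) (hg : KilledBy g N') : KilledBy (f - g) (max N N') := fun u i hu => by
  rw [AlternatingMap.sub_apply, killedBy_mono (le_max_left _ _) hf u i hu,
    killedBy_mono (le_max_right _ _) hg u i hu, sub_zero]

theorem killedBy_curryLeft {k N : ℕ} {f : PolyField K n [⋀^Fin (k + 1)]→ₗ[K] K}
    (hf : KilledBy f N) (ω : PolyField K n) : KilledBy (f.curryLeft ω) N :=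
  fun u i hu => hf _ i.succ (by simpa using hu)

theorem killedBy_ceAlg {k N : ℕ} {f : PolyField K n [⋀^Fin k]→ₗ[K] K} (hf : KilledBy f N) :
    KilledBy (ceAlg K (PolyField K n) k f) (N + 1) := by
  intro u i hu
  rw [ceAlg_apply, ceFun]
  refine Finset.sum_eq_zero fun j _ => ?_
  rw [Finset.sum_eq_zero, mul_zero]
  intro l _
  split_ifs with hl
  · by_cases hij : i = j
    · subst hij
      refine hf _ l ?_
      rw [Function.update_self]
      exact lie_mem_vanishing_left _ hu
    · obtain ⟨i', rfl⟩ := Fin.exists_succAbove_eq hij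
      by_cases hil : i' = l
      · subst hil
        refine hf _ i' ?_
        rw [Function.update_self, ← Fin.succAbove_of_castSucc_lt _ _ hl]
        exact lie_mem_vanishing_right _ hu
      · refine hf _ i' ?_
        rw [Function.update_of_ne hil]
        exact vanishing_anti (Nat.le_succ N) hu
  · rfl

/-- Differentials of finite forms (and zero in degree `0`). -/
def finExact (K : Type*) [Field K] (n : ℕ) : ∀ k : ℕ, (PolyField K n [⋀^Fin k]→ₗ[K] K) → Prop
  | 0, c => c = 0
  | k + 1, c => ∃ b : PolyField K n [⋀^Fin k]→ₗ[K] K,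
      (∃ N, KilledBy b N) ∧ c = ceAlg K (PolyField K n) k b

theorem finExact_sub {k : ℕ} {c c' : PolyField K n [⋀^Fin k]→ₗ[K] K} (hc : finExact K n k c)
    (hc' : finExact K n k c') : finExact K n k (c - c') := by
  cases k with
  | zero =>
    change c = 0 at hc
    change c' = 0 at hc'
    change c - c' = 0
    rw [hc, hc', sub_zero]
  | succ k =>
    obtain ⟨b, ⟨N, hb⟩, rfl⟩ := hc
    obtain ⟨b', ⟨N', hb'⟩, rfl⟩ := hc'
    exact ⟨b - b', ⟨_, killedBy_sub hb hb'⟩, (map_sub _ _ _).symm⟩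

theorem finExact_killedBy {k : ℕ} {c : PolyField K n [⋀^Fin k]→ₗ[K] K} (hc : finExact K n k c) :
    ∃ N, KilledBy c N := by
  cases k with
  | zero => exact ⟨0, fun _ i => i.elim0⟩
  | succ k =>
    obtain ⟨b, ⟨N, hb⟩, rfl⟩ := hc
    exact ⟨_, killedBy_ceAlg hb⟩

theorem finExact_closed {k : ℕ} {c : PolyField K n [⋀^Fin k]→ₗ[K] K} (hc : finExact K n k c) :
    ceAlg K (PolyField K n) k c = 0 := by
  cases k with
  | zero =>
    change c = 0 at hc
    rw [hc, map_zero]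
  | succ k =>
    obtain ⟨b, -, rfl⟩ := hc
    exact ceAlg_ceAlg b

/-- Forms of degree `k` closed on `I` modulo `N` can be made to vanish on `J` modulo some `N'` by
subtracting differentials of finite forms. -/
def Reducible (k : ℕ) (I : Submodule K (PolyField K n)) (N : ℕ) (J : Submodule K (PolyField K n)) :
    Prop :=
  ∃ N', ∀ f : PolyField K n [⋀^Fin k]→ₗ[K] K, (∃ M, KilledBy f M) →
    KilledOn I (ceAlg K (PolyField K n) k f) N → ∃ c, finExact K n k c ∧ KilledOn J (f - c) N'

/-- The bracket has order 2e - 1, and this is at least e + 1 because e ≥ 2. So any subspace between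
two consecutive steps of the filtration is a subalgebra, normalized by every field of order `e`. -/
theorem lie_mem_of_layer {e : ℕ} (he : 2 ≤ e) {J : Submodule K (PolyField K n)}
    (hJ : vanishing K n (e + 1) ≤ J) {x y : PolyField K n} (hx : x ∈ vanishing K n e)
    (hy : y ∈ vanishing K n e) : ⁅x, y⁆ ∈ J :=
  hJ (vanishing_anti (by omega) (lie_mem_vanishing hx hy))

/-- Enlarging `J` by one vector. -/
theorem Reducible.sup_span {k e N : ℕ} (he : 2 ≤ e) {I J : Submodule K (PolyField K n)}
    {ω : PolyField K n} (hJ : vanishing K n (e + 1) ≤ J) (hJe : J ≤ vanishing K n e)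
    (hω : ω ∈ vanishing K n e) (hJI : J ≤ I) (hωI : ω ∈ I) (hred : ∀ N, Reducible k J N J)
    (h : Reducible (k + 1) I N J) : Reducible (k + 1) I N (J ⊔ K ∙ ω) := by
  by_cases hωJ : ω ∈ J
  · have : J ⊔ K ∙ ω = J :=
      sup_eq_left.2 ((Submodule.span_singleton_le_iff_mem _ _).2 hωJ)
    rwa [this]
  have hJJ : ∀ x ∈ J, ∀ y ∈ J, ⁅x, y⁆ ∈ J := fun x hx y hy =>
    lie_mem_of_layer he hJ (hJe hx) (hJe hy)
  have hωJJ : ∀ x ∈ J, ⁅ω, x⁆ ∈ J := fun x hx => lie_mem_of_layer he hJ hω (hJe hx)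
  obtain ⟨φ, hφω, hφJ⟩ : ∃ φ : PolyField K n →ₗ[K] K, φ ω = 1 ∧ ∀ x ∈ J, φ x = 0 := by
    obtain ⟨φ, hφ, hφJ⟩ := Submodule.exists_le_ker_of_notMem hωJ
    refine ⟨(φ ω)⁻¹ • φ, ?_, fun x hx => ?_⟩
    · simp [hφ]
    · have : φ x = 0 := hφJ hx
      simp [this]
  obtain ⟨N₁, h₁⟩ := h
  -- The contraction of `f - c` with `ω` is closed on `J` modulo this bound: by Cartan's formula,
  -- `N` takes care of df and `N₁` of the Lie derivative of `f - c`. All bounds are fixed before `f`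
  -- is chosen.
  obtain ⟨N₃, h₃⟩ := hred (max N N₁)
  refine ⟨max (max N₁ N₃) (e + 1), fun f hf hdf => ?_⟩
  obtain ⟨c, hc, hfc⟩ := h₁ f hf hdf
  obtain ⟨M, hM⟩ := hf
  obtain ⟨Mc, hMc⟩ := finExact_killedBy hc
  have hd1 : ceAlg K (PolyField K n) (k + 1) (f - c) = ceAlg K (PolyField K n) (k + 1) f := by
    rw [map_sub, finExact_closed hc, sub_zero]
  obtain ⟨c', hc', hgc⟩ := h₃ ((f - c).curryLeft ω)
    ⟨_, killedBy_curryLeft (killedBy_sub hM hMc) ω⟩ (by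
      intro u i hu hui
      have h1 : ceAlg K (PolyField K n) (k + 1) f (Matrix.vecCons ω u) = 0 := by
        refine hdf _ i.succ (fun j => ?_) ?_
        · refine Fin.cases ?_ (fun j => ?_) j
          · simpa using hωI
          · simpa using hJI (hu j)
        · simpa using vanishing_anti (le_max_left _ _) hui
      rw [← hd1, ceAlg_apply, ceFun_vecCons, ← ceAlg_apply, sub_eq_zero] at h1
      rw [← h1, lieDer_apply, Finset.sum_eq_zero, neg_zero]
      intro l _
      refine hfc _ i (fun j => ?_) ?_
      · by_cases hjl : j = l
        · subst hjl
          rw [Function.update_self]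
          exact hωJJ _ (hu j)
        · rw [Function.update_of_ne hjl]
          exact hu j
      · refine vanishing_anti (le_max_right N N₁) ?_
        by_cases hil : i = l
        · subst hil
          rw [Function.update_self]
          exact vanishing_anti (by omega) (lie_mem_vanishing hω hui)
        · rwa [Function.update_of_ne hil])
  -- If c' = da, then d(φ ∧ a) vanishes on tuples in `J`, and its contraction with `ω` is -da there.
  -- It corrects the contraction of `f - c` without disturbing what is known on `J`. In degree 0
  -- nothing needs correction, since c' = 0.
  obtain ⟨c₂, hc₂, hc₂J, hc₂ω⟩ : ∃ c₂, finExact K n (k + 1) c₂ ∧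
      (∀ u, (∀ j, u j ∈ J) → c₂ u = 0) ∧
      ∀ u, (∀ j, u j ∈ J) → c₂ (Matrix.vecCons ω u) = -c' u := by
    cases k with
    | zero =>
      change c' = 0 at hc'
      subst hc'
      exact ⟨0, ⟨0, ⟨0, fun _ _ _ => rfl⟩, (map_zero _).symm⟩, fun _ _ => rfl, fun _ _ => by simp⟩
    | succ k =>
      obtain ⟨a, ⟨Na, ha⟩, rfl⟩ := hc'
      refine ⟨_, ⟨wedge φ a, ⟨max Na (e + 1), fun u i hu => ?_⟩, rfl⟩, fun u hu => ?_,
        fun u hu => ceAlg_wedge_vecCons hJJ hωJJ hφω hφJ hu⟩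
      · rw [wedge_apply]
        refine Finset.sum_eq_zero fun j _ => ?_
        by_cases hij : i = j
        · subst hij
          rw [hφJ _ (hJ (vanishing_anti (le_max_right _ _) hu)), zero_mul, mul_zero]
        · obtain ⟨l, rfl⟩ := Fin.exists_succAbove_eq hij
          rw [ha _ l (vanishing_anti (le_max_left _ _) hu), mul_zero, mul_zero]
      · refine ceAlg_eq_zero_of_forall_mem hJJ (fun v hv => ?_) hu
        rw [wedge_apply]
        exact Finset.sum_eq_zero fun i _ => by rw [hφJ _ (hv i), zero_mul, mul_zero]
  refine ⟨c - c₂, finExact_sub hc hc₂, fun u i hu hui => ?_⟩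
  refine eq_zero_of_sup_span_of_curryLeft (F := f - (c - c₂))
    (S := vanishing K n (max (max N₁ N₃) (e + 1)))
    (fun x hx => hJ (vanishing_anti (le_max_right _ _) hx)) ?_ ?_ hu hui
  · intro v i hv hvi
    have h1 := hfc v i hv (vanishing_anti ((le_max_left _ _).trans (le_max_left _ _)) hvi)
    rw [AlternatingMap.sub_apply] at h1 ⊢
    rw [AlternatingMap.sub_apply, hc₂J v hv, sub_zero, h1]
  · intro v i hv hvi
    have h1 := hgc v i hv (vanishing_anti ((le_max_right _ _).trans (le_max_left _ _)) hvi)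
    rw [AlternatingMap.sub_apply, AlternatingMap.curryLeft_apply_apply,
      AlternatingMap.sub_apply] at h1
    rw [AlternatingMap.sub_apply, AlternatingMap.sub_apply, hc₂ω v hv]
    linear_combination h1

theorem finite_setOf_degree_lt (n e : ℕ) : {α : Fin n →₀ ℕ | α.degree < e}.Finite := by
  refine (Finset.finite_toSet (Finset.Iic (Finsupp.equivFunOnFinite.symm fun _ : Fin n => e))).subset
    fun α hα => ?_
  rw [Finset.mem_coe, Finset.mem_Iic]
  intro i
  exact (Finsupp.le_degree i α).trans hα.le

/-- The exponents of total degree less than `e`. -/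
noncomputable def lowExponents (n e : ℕ) : Finset (Fin n →₀ ℕ) :=
  (finite_setOf_degree_lt n e).toFinset

theorem mem_lowExponents {e : ℕ} {α : Fin n →₀ ℕ} : α ∈ lowExponents n e ↔ α.degree < e := by
  simp [lowExponents]

/-- The vector field with prescribed coefficients in degrees less than `e`. -/
noncomputable def ofCoeff (K : Type*) [Field K] (n e : ℕ) :
    (Fin n → (Fin n →₀ ℕ) → K) →ₗ[K] PolyField K n :=
  ∑ p : Fin n, ∑ α ∈ lowExponents n e,
    (LinearMap.toSpanSingleton K (PolyField K n) (monoField K α p)) ∘ₗ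
      LinearMap.proj α ∘ₗ LinearMap.proj p

theorem ofCoeff_apply (e : ℕ) (c : Fin n → (Fin n →₀ ℕ) → K) :
    ofCoeff K n e c = ∑ p, ∑ α ∈ lowExponents n e, c p α • monoField K α p := by
  simp [ofCoeff]

theorem coeff_ofCoeff (e : ℕ) (c : Fin n → (Fin n →₀ ℕ) → K) (p : Fin n) (m : Fin n →₀ ℕ) :
    coeff m (ofCoeff K n e c (X p)) = if m.degree < e then c p m else 0 := by
  classical
  have h : ofCoeff K n e c (X p) = Chain.component K p (ofCoeff K n e c) := rfl
  rw [h, ofCoeff_apply, map_sum, coeff_sum, Finset.sum_eq_single p]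
  · rw [map_sum, coeff_sum]
    have h1 : ∀ α, coeff m (Chain.component K p (c p α • monoField K α p))
        = if α = m then c p α else 0 := by
      intro α
      rw [map_smul, coeff_smul]
      change _ • coeff m (monoField K α p (X p)) = _
      rw [monoField_X, if_pos rfl, coeff_monomial]
      simp
    simp only [h1, Finset.sum_ite_eq', mem_lowExponents]
  · intro q _ hq
    rw [map_sum, coeff_sum]
    refine Finset.sum_eq_zero fun α _ => ?_
    rw [map_smul]
    change coeff m (_ • monoField K α q (X p)) = _
    rw [monoField_X, if_neg hq.symm, smul_zero, coeff_zero]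
  · exact fun h => absurd (Finset.mem_univ p) h

/-- The monomial fields of degree exactly `e` are finite in number, so each layer is crossed by
adjoining finitely many vectors. -/
theorem exists_vanishing_eq_sup_span (e : ℕ) : ∃ t : Finset (PolyField K n),
    (t : Set (PolyField K n)) ⊆ vanishing K n e ∧
      vanishing K n e = vanishing K n (e + 1) ⊔ Submodule.span K t := by
  classical
  set t : Finset (PolyField K n) := (Finset.univ ×ˢ
    (lowExponents n (e + 1)).filter fun α => e ≤ α.degree).image fun x => monoField K x.2 x.1 with ht
  have h : (t : Set (PolyField K n)) ⊆ vanishing K n e := by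
    intro u hu
    rw [ht, Finset.coe_image] at hu
    obtain ⟨⟨p, α⟩, hx, rfl⟩ := hu
    rw [Finset.mem_coe, Finset.mem_product, Finset.mem_filter] at hx
    exact monoField_mem_vanishing hx.2.2 _
  refine ⟨t, h, le_antisymm (fun u hu => ?_)
    (sup_le (vanishing_anti (Nat.le_succ e)) (Submodule.span_le.2 h))⟩
  have h1 : u - ofCoeff K n (e + 1) (fun p m => coeff m (u (X p))) ∈ vanishing K n (e + 1) := by
    intro p m hm
    rw [Derivation.sub_apply, coeff_sub, coeff_ofCoeff, if_pos hm, sub_self]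
  rw [← sub_add_cancel u (ofCoeff K n (e + 1) (fun p m => coeff m (u (X p))))]
  refine Submodule.add_mem_sup h1 ?_
  rw [ofCoeff_apply]
  refine Submodule.sum_mem _ fun p _ => Submodule.sum_mem _ fun α hα => ?_
  by_cases hαe : α.degree < e
  · rw [hu p α hαe, zero_smul]
    exact zero_mem _
  · refine Submodule.smul_mem _ _ (Submodule.subset_span ?_)
    rw [ht, Finset.coe_image]
    exact ⟨(p, α), by simpa [hα] using hαe, rfl⟩

/-- Enlarging `vanishing (e + 1)` by finitely many fields of order `e`. -/
theorem Reducible.sup_span_finset {k e N : ℕ} (he : 2 ≤ e) {I : Submodule K (PolyField K n)}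
    (hred : ∀ (t : Finset (PolyField K n)) (N : ℕ), (t : Set (PolyField K n)) ⊆ vanishing K n e →
      Reducible k (vanishing K n (e + 1) ⊔ Submodule.span K t) N
        (vanishing K n (e + 1) ⊔ Submodule.span K t))
    (h : Reducible (k + 1) I N (vanishing K n (e + 1))) (hI : vanishing K n (e + 1) ≤ I)
    (t : Finset (PolyField K n)) (ht : (t : Set (PolyField K n)) ⊆ vanishing K n e)
    (htI : (t : Set (PolyField K n)) ⊆ I) :
    Reducible (k + 1) I N (vanishing K n (e + 1) ⊔ Submodule.span K t) := by
  classical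
  induction t using Finset.induction_on with
  | empty => simpa using h
  | insert ω t _ ih =>
    rw [Finset.coe_insert, Set.insert_subset_iff] at ht htI
    rw [Finset.coe_insert, Submodule.span_insert, sup_comm (K ∙ ω), ← sup_assoc]
    exact (ih ht.2 htI.2).sup_span he le_sup_left
      (sup_le (vanishing_anti (Nat.le_succ e)) (Submodule.span_le.2 ht.2)) ht.1
      (sup_le hI (Submodule.span_le.2 htI.2)) htI.1 fun N => hred t N ht.2

/-- Induction on the degree, over all layers at once. `exists_primitive` settles fields of very high
order; adjoining finitely many fields at a time leads back through the layers to order `e + 1`, and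
then to `t`. Each step uses the preceding degree in its own layer. -/
theorem reducible_sup_span [CharZero K] (k : ℕ) : ∀ (e : ℕ), 2 ≤ e →
    ∀ (t : Finset (PolyField K n)) (N : ℕ), (t : Set (PolyField K n)) ⊆ vanishing K n e →
      Reducible k (vanishing K n (e + 1) ⊔ Submodule.span K t) N
        (vanishing K n (e + 1) ⊔ Submodule.span K t) := by
  induction k with
  | zero => exact fun e _ t N _ => ⟨0, fun f _ _ => ⟨0, rfl, fun _ i => i.elim0⟩⟩
  | succ k ih =>
    intro e he t N ht
    set I := vanishing K n (e + 1) ⊔ Submodule.span K t with hI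
    have hdesc : ∀ s, Reducible (k + 1) I N (vanishing K n (e + 1 + s)) →
        Reducible (k + 1) I N (vanishing K n (e + 1)) := by
      intro s
      induction s with
      | zero => exact fun h => h
      | succ s ihs =>
        intro h
        refine ihs ?_
        obtain ⟨t', ht', heq⟩ := exists_vanishing_eq_sup_span (K := K) (n := n) (e + 1 + s)
        rw [heq]
        have hle : vanishing K n (e + 1 + s) ≤ I :=
          (vanishing_anti (Nat.le_add_right _ _)).trans le_sup_left
        exact Reducible.sup_span_finset (e := e + 1 + s) (by omega) (ih _ (by omega)) h
          ((vanishing_anti (Nat.le_succ _)).trans hle) t' ht' (ht'.trans hle)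
    have hbase : Reducible (k + 1) I N (vanishing K n (e + 1)) := by
      -- On fields of order at least `N`, closed modulo `N` means closed. The primitive then removes
      -- `f` altogether on the deep layer, so the bound 0 suffices there.
      obtain ⟨e', he'⟩ := exists_primitive (K := K) n k (max N (e + 1))
      refine hdesc e' ⟨0, fun f hf hdf => ?_⟩
      obtain ⟨b, hb, hfb⟩ := he' f hf fun u hu => hdf u 0
        (fun j => le_sup_left (a := vanishing K n (e + 1)) (vanishing_anti (le_max_right _ _) (hu j)))
        (vanishing_anti (le_max_left _ _) (hu 0))
      refine ⟨_, ⟨b, hb, rfl⟩, fun u i hu _ => ?_⟩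
      rw [AlternatingMap.sub_apply, hfb u fun j => vanishing_anti (Nat.le_add_left _ _) (hu j),
        sub_self]
    exact hbase.sup_span_finset he (ih e he) le_sup_left t ht
      (Submodule.span_le.1 le_sup_right)

end PolyField

/-! ### Decomposition of forms by weight -/

namespace Chain

open MvPolynomial LieCohomology PolyField

variable {K : Type*} [Field K] {n m : ℕ}

theorem alternatingMap_sum_apply {R M ι κ : Type*} [CommRing R] [AddCommGroup M] [Module R M]
    (t : Finset κ) (F : κ → M [⋀^ι]→ₗ[R] R) (u : ι → M) : (∑ x ∈ t, F x) u = ∑ x ∈ t, F x u := by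
  classical
  induction t using Finset.induction_on with
  | empty => simp
  | insert x t hx ih => rw [Finset.sum_insert hx, Finset.sum_insert hx, AlternatingMap.add_apply, ih]

theorem homComponent_skew (a k : ℕ) (z : Chain K n m) :
    homComponent K n m k (skew a z) = skew a (homComponent K n m k z) := by
  suffices h : homComponent K n m k ∘ₗ skew a = skew a ∘ₗ homComponent K n m k from
    congrArg (fun F => F z) h
  refine hom_ext_isHomogeneous fun j z hz => ?_
  rw [LinearMap.comp_apply, LinearMap.comp_apply, homComponent_of_isHomogeneous _ hz,
    homComponent_of_isHomogeneous (j := j) _ (skew_isHomogeneous _ _ hz)]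
  split_ifs
  · rfl
  · rw [map_zero]

/-- The part of a form of weight `k` with respect to the total degree. -/
theorem exists_weightPart [CharZero K] (f : PolyField K n [⋀^Fin m]→ₗ[K] K) (k : ℕ) :
    ∃ g : PolyField K n [⋀^Fin m]→ₗ[K] K,
      ∀ z, hat g.toMultilinearMap z = hat f.toMultilinearMap (homComponent K n m k z) := by
  obtain ⟨N, hN, hNs⟩ := exists_hat_skew (K := K) (n := n) 0 m
  refine ⟨N⁻¹ • skewForm (hat f.toMultilinearMap ∘ₗ homComponent K n m k), fun z => ?_⟩
  have h : hat (N⁻¹ • skewForm (hat f.toMultilinearMap ∘ₗ homComponent K n m k)).toMultilinearMap z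
      = N⁻¹ * hat (skewForm (hat f.toMultilinearMap ∘ₗ homComponent K n m k)).toMultilinearMap z :=
    hat_eq_mul_hat _ _ _ _ fun p α _ => rfl
  rw [h, hat_skewForm, LinearMap.comp_apply, homComponent_skew, hNs, inv_mul_cancel_left₀ hN]

theorem hat_tens' (f : PolyField K n [⋀^Fin m]→ₗ[K] K) (u : Fin m → PolyField K n) :
    hat f.toMultilinearMap (tens K n m u) = f u := hat_tens _ u

theorem killedBy_weightPart {f g : PolyField K n [⋀^Fin m]→ₗ[K] K} {k : ℕ}
    (hg : ∀ z, hat g.toMultilinearMap z = hat f.toMultilinearMap (homComponent K n m k z)) :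
    KilledBy g (k + 1) := by
  intro u i hu
  rw [← hat_tens', hg, homComponent_tens_eq_zero (Nat.lt_succ_self k) hu, map_zero]

theorem lieDer_euler_weightPart {f g : PolyField K n [⋀^Fin m]→ₗ[K] K} {k : ℕ}
    (hg : ∀ z, hat g.toMultilinearMap z = hat f.toMultilinearMap (homComponent K n m k z)) :
    lieDer (euler K n) g = -((k : K) - m) • g := by
  ext u
  rw [← hat_tens', AlternatingMap.smul_apply, ← hat_tens']
  suffices h : hat (lieDer (euler K n) g).toMultilinearMap
      = -((k : K) - m) • hat g.toMultilinearMap from congrArg (fun F => F (tens K n m u)) h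
  refine hom_ext_isHomogeneous fun j z hz => ?_
  rw [hat_lieDer_euler _ hz, LinearMap.smul_apply, smul_eq_mul, hg,
    homComponent_of_isHomogeneous _ hz]
  split_ifs with h
  · rw [h]
  · simp

/-- The differential preserves weight. As powers of `axesIdeal` are graded, the homogeneous
components of a tensor of fields of order `d` are again made of such fields, so `hf` applies to each
of them. -/
theorem ceAlg_weightPart [CharZero K] {f g : PolyField K n [⋀^Fin m]→ₗ[K] K} {k : ℕ}
    (hg : ∀ z, hat g.toMultilinearMap z = hat f.toMultilinearMap (homComponent K n m k z)) {d : ℕ}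
    (hf : ∀ u, (∀ j, u j ∈ vanishing K n d) → ceAlg K (PolyField K n) m f u = 0)
    {u : Fin (m + 1) → PolyField K n} (hu : ∀ j, u j ∈ vanishing K n d) :
    ceAlg K (PolyField K n) m g u = 0 := by
  obtain ⟨N, hN, hNs⟩ := exists_hat_skew (K := K) (n := n) 0 m
  have h1 : hat (ceAlg K (PolyField K n) m f).toMultilinearMap
      (homComponent K n (m + 1) (k + 1) (tens K n (m + 1) u)) = 0 :=
    hat_eq_zero _ _ fun p α hα => hf _ fun i => slotFields_mem_vanishing le_rfl
      (SlotPoly.containsComponents_axesIdeal_pow d _ (tens_mem_axesIdeal hu p) (k + 1)) hα p i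
  rw [← hat_tens', hat_ceAlg, hg]
  refine (mul_eq_zero.1 ?_).resolve_left hN
  rw [← hNs, ← homComponent_skew]
  change hat _ (homComponent K n m k (skewBoundary K n m (tens K n (m + 1) u))) = 0
  rw [homComponent_skewBoundary]
  change hat _ (skew 0 (boundary 0 _)) = 0
  rw [hNs, ← hat_ceAlg, h1, mul_zero]

end Chain

/-! ### The uniform bound for every d -/

namespace PolyField

open MvPolynomial LieCohomology Chain

variable {K : Type*} [Field K] {n : ℕ}

theorem euler_mem_vanishing {d : ℕ} (hd : d ≤ 1) : euler K n ∈ vanishing K n d := by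
  rw [mem_vanishing_iff]
  intro p
  rw [euler_X]
  refine Ideal.pow_le_pow_right hd ?_
  rw [pow_one]
  exact Ideal.subset_span ⟨p, rfl⟩

/-- E has order one and so lies in the subalgebra. By Cartan's formula the part of degree `m ≠ k +
1` is a multiple of the differential of its contraction with E. The part of weight zero reads
exactly degree `k + 1`, so order `k + 2` kills it. -/
theorem exists_finExact_of_le_one [CharZero K] {d : ℕ} (hd : d ≤ 1) (k : ℕ)
    {f : PolyField K n [⋀^Fin (k + 1)]→ₗ[K] K} (hfin : ∃ M, KilledBy f M)
    (hf : ∀ u, (∀ j, u j ∈ vanishing K n d) → ceAlg K (PolyField K n) (k + 1) f u = 0) :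
    ∃ c, finExact K n (k + 1) c ∧ KilledOn (vanishing K n d) (f - c) (k + 2) := by
  obtain ⟨M, hM⟩ := hfin
  choose g hg using exists_weightPart f
  -- The first bound makes the parts of degree less than `T` add up to `f`; the second ensures that
  -- degree `k + 1` is among them.
  set T := max ((k + 1) * M) (k + 2)
  have hsum : ∀ u, f u = ∑ m ∈ Finset.range T, g m u := by
    intro u
    rw [← hat_tens', ← hat_truncate hM (Nat.succ_pos k) (le_max_left _ (k + 2)), truncate,
      LinearMap.sum_apply, map_sum]
    exact Finset.sum_congr rfl fun m _ => by rw [← hg, hat_tens']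
  have hprim : ∀ m, m ≠ k + 1 → ∀ u, (∀ j, u j ∈ vanishing K n d) →
      ceAlg K (PolyField K n) k (-((m : K) - (k + 1 : ℕ))⁻¹ • (g m).curryLeft (euler K n)) u
        = g m u := by
    intro m hm u hu
    have h0 : (m : K) - (k + 1 : ℕ) ≠ 0 := sub_ne_zero.2 (by exact_mod_cast hm)
    have h1 : ceAlg K (PolyField K n) (k + 1) (g m) (Matrix.vecCons (euler K n) u) = 0 := by
      refine ceAlg_weightPart (hg m) hf fun j => ?_
      refine Fin.cases ?_ (fun j => ?_) j
      · simpa using euler_mem_vanishing hd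
      · simpa using hu j
    rw [ceAlg_apply, ceFun_vecCons, ← ceAlg_apply, lieDer_euler_weightPart (hg m), sub_eq_zero] at h1
    rw [map_smul, AlternatingMap.smul_apply, ← h1, AlternatingMap.smul_apply, smul_smul, neg_mul_neg,
      inv_mul_cancel₀ h0, one_smul]
  refine ⟨_, ⟨∑ m ∈ (Finset.range T).erase (k + 1),
    -((m : K) - (k + 1 : ℕ))⁻¹ • (g m).curryLeft (euler K n), ⟨T, fun u i hu => ?_⟩, rfl⟩,
    fun u i hu hui => ?_⟩
  · rw [alternatingMap_sum_apply]
    refine Finset.sum_eq_zero fun m hm => ?_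
    rw [AlternatingMap.smul_apply, killedBy_curryLeft (killedBy_weightPart (hg m)) _ u i
      (vanishing_anti (Finset.mem_range.1 (Finset.mem_of_mem_erase hm)) hu), smul_zero]
  · rw [AlternatingMap.sub_apply, map_sum, alternatingMap_sum_apply, hsum, ← Finset.add_sum_erase _ _
      (Finset.mem_range.2 (lt_of_lt_of_le (Nat.lt_succ_self (k + 1)) (le_max_right _ _))),
      Finset.sum_congr rfl fun m hm => hprim m (Finset.ne_of_mem_erase hm) u hu, add_sub_cancel_right]
    exact killedBy_weightPart (hg (k + 1)) u i hui

/-- Finite forms closed on fields of order at least `d` are, up to differentials of finite forms,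
killed by a fixed order. -/
theorem exists_finExact_killedOn [CharZero K] (n d k : ℕ) :
    ∃ N', ∀ f : PolyField K n [⋀^Fin k]→ₗ[K] K, (∃ M, KilledBy f M) →
      (∀ u, (∀ j, u j ∈ vanishing K n d) → ceAlg K (PolyField K n) k f u = 0) →
      ∃ c, finExact K n k c ∧ KilledOn (vanishing K n d) (f - c) N' := by
  -- The descent through layers needs order at least two; below that the Euler field is available.
  by_cases hd : 2 ≤ d
  · obtain ⟨t, ht, heq⟩ := exists_vanishing_eq_sup_span (K := K) (n := n) d
    obtain ⟨N', h⟩ := reducible_sup_span (K := K) k d hd t 0 ht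
    rw [← heq] at h
    exact ⟨N', fun f hf hdf => h f hf fun u _ hu _ => hdf u hu⟩
  · cases k with
    | zero => exact ⟨0, fun f _ _ => ⟨0, rfl, fun _ i => i.elim0⟩⟩
    | succ k => exact ⟨k + 2, fun f hfin hf => exists_finExact_of_le_one (by omega) k hfin hf⟩

end PolyField

/-! ### Passage between polynomial and formal vector fields -/

namespace FormalVectorField

open LieCohomology

section Truncation

variable {K : Type*} [Field K] {n : ℕ}

/-- Polynomial vector fields as formal vector fields. -/
noncomputable def ofPoly (K : Type*) [Field K] (n : ℕ) :
    PolyField K n →ₗ[K] FormalVectorField K n where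
  toFun u := fun p => (u (MvPolynomial.X p) : MvPowerSeries (Fin n) K)
  map_add' u v := by
    ext1 p
    exact MvPolynomial.coe_add _ _
  map_smul' c u := by
    ext1 p
    exact MvPolynomial.coe_smul _ _

theorem ofPoly_apply (u : PolyField K n) (p : Fin n) :
    ofPoly K n u p = (u (MvPolynomial.X p) : MvPowerSeries (Fin n) K) := rfl

theorem deriv_ofPoly (u : PolyField K n) (g : MvPolynomial (Fin n) K) :
    deriv (ofPoly K n u) (g : MvPowerSeries (Fin n) K) = (u g : MvPowerSeries (Fin n) K) := by
  rw [deriv_apply, ← Chain.sum_pderiv]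
  refine Eq.trans ?_ (map_sum (MvPolynomial.coeToMvPowerSeries.ringHom (R := K) (σ := Fin n))
    (fun a => u (MvPolynomial.X a) * MvPolynomial.pderiv a g) Finset.univ).symm
  refine Finset.sum_congr rfl fun a _ => ?_
  rw [ofPoly_apply, MvPowerSeries.pderiv_coe, map_mul]
  rfl

theorem ofPoly_lie (u v : PolyField K n) : ofPoly K n ⁅u, v⁆ = ⁅ofPoly K n u, ofPoly K n v⁆ := by
  ext1 p
  rw [lie_apply, ofPoly_apply, ofPoly_apply, ofPoly_apply, deriv_ofPoly, deriv_ofPoly,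
    Derivation.commutator_apply]
  exact map_sub (MvPolynomial.coeToMvPowerSeries.ringHom (R := K) (σ := Fin n)) _ _

theorem ofPoly_mem_vanishing {e : ℕ} {u : PolyField K n} (hu : u ∈ PolyField.vanishing K n e) :
    ofPoly K n u ∈ vanishing K n e := fun p m hm => by
  rw [ofPoly_apply, MvPolynomial.coeff_coe]
  exact hu p m hm

/-- The coefficients of a formal vector field. -/
noncomputable def coeffs (K : Type*) [Field K] (n : ℕ) :
    FormalVectorField K n →ₗ[K] (Fin n → (Fin n →₀ ℕ) → K) where
  toFun v := fun p α => MvPowerSeries.coeff α (v p)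
  map_add' v w := by
    funext p α
    rw [add_apply, map_add]
    rfl
  map_smul' c v := by
    funext p α
    rw [smul_apply, map_smul]
    rfl

/-- Truncation of formal vector fields in degrees less than `N`. -/
noncomputable def trunc (K : Type*) [Field K] (n N : ℕ) :
    FormalVectorField K n →ₗ[K] PolyField K n :=
  PolyField.ofCoeff K n N ∘ₗ coeffs K n

theorem coeff_trunc (N : ℕ) (v : FormalVectorField K n) (p : Fin n) (m : Fin n →₀ ℕ) :
    MvPolynomial.coeff m (trunc K n N v (MvPolynomial.X p))
      = if m.degree < N then MvPowerSeries.coeff m (v p) else 0 :=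
  PolyField.coeff_ofCoeff N _ p m

theorem trunc_mem_vanishing {e : ℕ} (N : ℕ) {v : FormalVectorField K n} (hv : v ∈ vanishing K n e) :
    trunc K n N v ∈ PolyField.vanishing K n e := fun p m hm => by
  rw [coeff_trunc, hv p m hm, ite_self]

theorem sub_ofPoly_trunc_mem (N : ℕ) (v : FormalVectorField K n) :
    v - ofPoly K n (trunc K n N v) ∈ vanishing K n N := fun p m hm => by
  rw [sub_apply, map_sub, ofPoly_apply, MvPolynomial.coeff_coe, coeff_trunc, if_pos hm, sub_self]

theorem sub_trunc_ofPoly_mem (N : ℕ) (u : PolyField K n) :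
    u - trunc K n N (ofPoly K n u) ∈ PolyField.vanishing K n N := fun p m hm => by
  rw [Derivation.sub_apply, MvPolynomial.coeff_sub, coeff_trunc, if_pos hm, ofPoly_apply,
    MvPolynomial.coeff_coe, sub_self]

/-- The elements of `L_d(n)` that lie in `L_N(n)`. -/
noncomputable def subVanishing (K : Type*) [Field K] (n d N : ℕ) :
    Submodule K (vanishing K n d) where
  carrier := {v | (v : FormalVectorField K n) ∈ vanishing K n N}
  add_mem' hv hw := (vanishing K n N).add_mem hv hw
  zero_mem' := (vanishing K n N).zero_mem
  smul_mem' c _ hv := (vanishing K n N).smul_mem c hv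

theorem subVanishing_anti {d N N' : ℕ} (h : N ≤ N') : subVanishing K n d N' ≤ subVanishing K n d N :=
  fun _ hv => vanishing_anti h hv

/-- Polynomial vector fields of order at least `d` as elements of `L_d(n)`. -/
noncomputable def ofPolyVanishing (K : Type*) [Field K] (n d : ℕ) :
    PolyField.vanishing K n d →ₗ[K] vanishing K n d where
  toFun u := ⟨ofPoly K n u, ofPoly_mem_vanishing u.2⟩
  map_add' _ _ := Subtype.ext (map_add (ofPoly K n) _ _)
  map_smul' _ _ := Subtype.ext (map_smul (ofPoly K n) _ _)

/-- Truncation as a map on `L_d(n)`. -/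
noncomputable def truncVanishing (K : Type*) [Field K] (n d N : ℕ) :
    vanishing K n d →ₗ[K] PolyField.vanishing K n d where
  toFun v := ⟨trunc K n N v, trunc_mem_vanishing N v.2⟩
  map_add' _ _ := Subtype.ext (map_add (trunc K n N) _ _)
  map_smul' _ _ := Subtype.ext (map_smul (trunc K n N) _ _)

/-- The polynomial fields of degree less than `N` in `L_d(n)`. -/
noncomputable def lowPart (K : Type*) [Field K] (n d N : ℕ) : Submodule K (vanishing K n d) :=
  LinearMap.range (ofPolyVanishing K n d ∘ₗ truncVanishing K n d N)

theorem sub_mem_subVanishing {d : ℕ} (N : ℕ) (v : vanishing K n d) :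
    v - (ofPolyVanishing K n d ∘ₗ truncVanishing K n d N) v ∈ subVanishing K n d N :=
  sub_ofPoly_trunc_mem N _

theorem subVanishing_sup_lowPart (d N : ℕ) : subVanishing K n d N ⊔ lowPart K n d N = ⊤ := by
  refine eq_top_iff.2 fun v _ => ?_
  rw [← sub_add_cancel v ((ofPolyVanishing K n d ∘ₗ truncVanishing K n d N) v)]
  exact Submodule.add_mem_sup (sub_mem_subVanishing N v) ⟨v, rfl⟩

theorem finite_lowPart (d N : ℕ) : Module.Finite K (lowPart K n d N) := by
  let R : lowPart K n d N →ₗ[K] (Fin n → PolyField.lowExponents n N → K) :=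
    { toFun := fun v p α => MvPowerSeries.coeff α.1 ((v.1 : FormalVectorField K n) p)
      map_add' := fun v w => by
        funext p α
        exact map_add _ _ _
      map_smul' := fun c v => by
        funext p α
        exact map_smul (MvPowerSeries.coeff α.1) _ _ }
  refine Module.Finite.of_injective R ((injective_iff_map_eq_zero R).2 ?_)
  rintro ⟨_, v, rfl⟩ hv
  refine Subtype.ext (Subtype.ext (FormalVectorField.ext fun p => MvPowerSeries.ext fun m => ?_))
  change MvPowerSeries.coeff m (ofPoly K n (trunc K n N v) p) = 0
  by_cases hm : m.degree < N
  · exact congrFun (congrFun hv p) ⟨m, PolyField.mem_lowExponents.2 hm⟩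
  · rw [ofPoly_apply, MvPolynomial.coeff_coe, coeff_trunc, if_neg hm]

end Truncation

section Forms

variable {K L : Type*} [Field K] [AddCommGroup L] [Module K L]

/-- The arguments are exchanged one at a time, each exchange changing the value by a term with an
entry in `S`. -/
theorem alternatingMap_congr {k : ℕ} {c : L [⋀^Fin k]→ₗ[K] K} {S : Submodule K L}
    (hc : ∀ v i, v i ∈ S → c v = 0) {u v : Fin k → L} (huv : ∀ j, u j - v j ∈ S) : c u = c v := by
  classical
  suffices h : ∀ s : Finset (Fin k), c (s.piecewise v u) = c u by
    rw [← h Finset.univ, Finset.piecewise_univ]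
  intro s
  induction s using Finset.induction_on with
  | empty => rw [Finset.piecewise_empty]
  | insert j s hj ih =>
    have h1 : v j = u j - (u j - v j) := by abel
    have h2 : Function.update (s.piecewise v u) j (u j) = s.piecewise v u := by
      rw [Function.update_eq_self_iff, Finset.piecewise_eq_of_notMem _ _ _ hj]
    have h3 : c (Function.update (s.piecewise v u) j (u j - v j)) = 0 :=
      hc _ j (by rw [Function.update_self]; exact huv j)
    rw [Finset.piecewise_insert, h1, AlternatingMap.map_update_sub, h2, ih, h3, sub_zero]

end Forms

/-! ### Continuous forms are those killed by some order -/

section Continuity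

variable {K : Type*} [Field K] {n d : ℕ}

theorem nhds_hasBasis (v : vanishing K n d) : (𝓝 v).HasBasis (fun _ : ℕ => True)
    fun N => {w | w - v ∈ subVanishing K n d N} := by
  have h : (𝓝 (v : FormalVectorField K n)).HasBasis (fun _ : ℕ => True)
      fun N => {w | w - v ∈ vanishing K n N} := by
    rw [← nhds_translation_sub]
    exact nhds_zero_hasBasis.comap _
  rw [nhds_subtype_eq_comap]
  exact h.comap _

/-- Such a form is locally constant, hence continuous for any topology on `K`. -/
theorem continuous_of_killed [TopologicalSpace K] {k N : ℕ} {c : vanishing K n d [⋀^Fin k]→ₗ[K] K}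
    (hc : ∀ v i, v i ∈ subVanishing K n d N → c v = 0) : Continuous c := by
  rw [continuous_iff_continuousAt]
  intro v
  refine Filter.Tendsto.congr' (f₁ := fun _ => c v) ?_ tendsto_const_nhds
  have : ∀ᶠ w in 𝓝 v, ∀ j, w j - v j ∈ subVanishing K n d N := by
    refine Filter.eventually_all.2 fun j => ?_
    exact (continuous_apply j).continuousAt.eventually ((nhds_hasBasis (v j)).mem_of_mem trivial)
  filter_upwards [this] with w hw
  exact (alternatingMap_congr hc hw).symm

theorem exists_subVanishing_of_mem_nhds {k : ℕ} {s : Set (Fin k → vanishing K n d)}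
    (hs : s ∈ 𝓝 (0 : Fin k → vanishing K n d)) :
    ∃ N, ∀ v : Fin k → vanishing K n d, (∀ i, v i ∈ subVanishing K n d N) → v ∈ s := by
  rw [nhds_pi, Filter.mem_pi'] at hs
  obtain ⟨I, t, ht, hts⟩ := hs
  choose N _ hN using fun i => (nhds_hasBasis (0 : vanishing K n d)).mem_iff.1 (ht i)
  refine ⟨Finset.univ.sup N, fun v hv => hts fun i _ => hN i ?_⟩
  rw [Set.mem_ofPred_eq, sub_zero]
  exact subVanishing_anti (Finset.le_sup (Finset.mem_univ i)) (hv i)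

/-- A continuous alternating form is killed by some `L_N(n)`. -/
theorem exists_killed [TopologicalSpace K] [T2Space K] {k : ℕ}
    (c : vanishing K n d [⋀^Fin k]→ₗ[K] K) (hc : Continuous c) :
    ∃ N, ∀ v i, v i ∈ subVanishing K n d N → c v = 0 := by
  classical
  induction k with
  | zero => exact ⟨0, fun _ i => i.elim0⟩
  | succ k ih =>
    obtain ⟨N₀, h₀⟩ : ∃ N₀, ∀ v : Fin (k + 1) → vanishing K n d,
        (∀ i, v i ∈ subVanishing K n d N₀) → c v = 0 := by
      -- Only the fact that the complement of 1 is a neighbourhood of 0 is needed: the fields of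
      -- order `N₀` form a subspace, so a nonzero value could be rescaled to 1.
      obtain ⟨N₀, h⟩ := exists_subVanishing_of_mem_nhds (s := c ⁻¹' {1}ᶜ)
        (hc.continuousAt.preimage_mem_nhds (isOpen_compl_singleton.mem_nhds (by
          rw [c.map_zero]
          exact zero_ne_one)))
      refine ⟨N₀, fun v hv => ?_⟩
      by_contra hcv
      refine h (Function.update v 0 ((c v)⁻¹ • v 0)) (fun i => ?_) ?_
      · by_cases hi : i = 0
        · subst hi
          rw [Function.update_self]
          exact Submodule.smul_mem _ _ (hv 0)
        · rw [Function.update_of_ne hi]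
          exact hv i
      · change c _ = 1
        rw [AlternatingMap.map_update_smul, Function.update_eq_self, smul_eq_mul,
          inv_mul_cancel₀ hcv]
    have hcx : ∀ x, Continuous (c.curryLeft x) := by
      intro x
      refine hc.comp (continuous_pi fun j => ?_)
      refine Fin.cases ?_ (fun j => ?_) j
      · exact continuous_const
      · exact continuous_apply j
    choose N hN using fun x => ih (c.curryLeft x) (hcx x)
    -- Together with the fields of order `N₀`, the finite-dimensional `lowPart` spans everything.
    -- Contractions with finitely many spanning vectors have a common bound.
    obtain ⟨t, ht⟩ := (Submodule.fg_iff_finiteDimensional (lowPart K n d N₀)).2 (finite_lowPart d N₀)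
    set N' := max N₀ (t.sup N)
    have hlow : ∀ y ∈ lowPart K n d N₀, ∀ v i, v i ∈ subVanishing K n d N' →
        c (Matrix.vecCons y v) = 0 := by
      intro y hy v i hv
      rw [← ht] at hy
      rw [← AlternatingMap.curryLeft_apply_apply]
      induction hy using Submodule.span_induction with
      | mem x hx =>
        exact hN x v i (subVanishing_anti ((Finset.le_sup hx).trans (le_max_right _ _)) hv)
      | zero => simp
      | add x y _ _ hx hy => rw [map_add, AlternatingMap.add_apply, hx, hy, add_zero]
      | smul a x _ hx => rw [map_smul, AlternatingMap.smul_apply, hx, smul_zero]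
    refine ⟨N', fun v i hv => ?_⟩
    have htop : ∀ v : Fin (k + 1) → vanishing K n d,
        ∀ j, v j ∈ subVanishing K n d N₀ ⊔ lowPart K n d N₀ := by
      intro v j
      rw [subVanishing_sup_lowPart]
      trivial
    refine eq_zero_of_sup (F := c) (J := subVanishing K n d N₀) (P := lowPart K n d N₀)
      (subVanishing_anti (le_max_left _ _)) (fun u hu _ => h₀ u hu)
      (fun u _ hui j hj y hy => ?_) (htop v) hv
    rw [← Fin.insertNth_removeNth, AlternatingMap.map_insertNth]
    obtain ⟨l, rfl⟩ := Fin.exists_succAbove_eq hj.symm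
    rw [hlow y hy _ l hui, smul_zero]

end Continuity

section Translation

variable {K : Type*} [Field K] {n d : ℕ}

theorem lie_mem_polyVanishing {u v : PolyField K n} (hu : u ∈ PolyField.vanishing K n d)
    (hv : v ∈ PolyField.vanishing K n d) : ⁅u, v⁆ ∈ PolyField.vanishing K n d := by
  cases d with
  | zero => exact fun _ _ h => absurd h (Nat.not_lt_zero _)
  | succ d => exact PolyField.vanishing_anti (by omega) (PolyField.lie_mem_vanishing hu hv)

/-- The differentials of a form on polynomial fields and a form on formal fields that agree on
polynomial fields of order at least `d` agree. -/
theorem ceAlg_ofPolyVanishing {k : ℕ} {f : PolyField K n [⋀^Fin k]→ₗ[K] K}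
    {c : vanishing K n d [⋀^Fin k]→ₗ[K] K}
    (h : ∀ u : Fin k → PolyField.vanishing K n d,
      f (fun j => u j) = c fun j => ofPolyVanishing K n d (u j))
    (u : Fin (k + 1) → PolyField.vanishing K n d) :
    ceAlg K (PolyField K n) k f (fun j => u j)
      = ceAlg K (vanishing K n d) k c fun j => ofPolyVanishing K n d (u j) := by
  rw [ceAlg_apply, ceAlg_apply, ceFun, ceFun]
  refine Finset.sum_congr rfl fun j _ => congrArg _ (Finset.sum_congr rfl fun i _ => ?_)
  split_ifs
  · have h1 := h (Function.update (j.removeNth u) i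
      ⟨⁅(u i.castSucc : PolyField K n), (u j : PolyField K n)⁆,
        lie_mem_polyVanishing (u i.castSucc).2 (u j).2⟩)
    refine Eq.trans (congrArg f (funext fun l => ?_)) (h1.trans (congrArg c (funext fun l => ?_)))
    · by_cases hl : l = i
      · subst hl
        simp
      · simp only [Function.update_of_ne hl]
        rfl
    · by_cases hl : l = i
      · subst hl
        simp only [Function.update_self]
        exact Subtype.ext (ofPoly_lie _ _)
      · simp only [Function.update_of_ne hl]
        rfl
  · rfl

end Translation

/-! ### Finiteness of the cohomology -/

section Cohomology

variable {K : Type*} [Field K] [TopologicalSpace K] [IsTopologicalRing K] {n d : ℕ}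

/-- The continuous forms on `L_d(n)` killed by `L_N(n)`. -/
noncomputable def killedForms (K : Type*) [Field K] [TopologicalSpace K] [IsTopologicalRing K]
    (n d N k : ℕ) : Submodule K (vanishing K n d [⋀^Fin k]→L[K] K) where
  carrier := {c | ∀ v i, v i ∈ subVanishing K n d N → c v = 0}
  add_mem' := by
    intro c c' hc hc' v i hv
    rw [ContinuousAlternatingMap.add_apply, hc v i hv, hc' v i hv, add_zero]
  zero_mem' := fun _ _ _ => rfl
  smul_mem' := by
    intro r c hc v i hv
    rw [ContinuousAlternatingMap.smul_apply, hc v i hv, smul_zero]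

/-- Such a form is determined by its values on polynomial fields of degree less than `N`, and these
form a finite-dimensional space. -/
theorem finite_killedForms (N k : ℕ) : Module.Finite K (killedForms K n d N k) := by
  have := finite_lowPart (K := K) (n := n) d N
  let R : killedForms K n d N k →ₗ[K] MultilinearMap K (fun _ : Fin k => lowPart K n d N) K :=
    { toFun := fun c => c.1.toMultilinearMap.compLinearMap fun _ => (lowPart K n d N).subtype
      map_add' := fun c c' => rfl
      map_smul' := fun r c => rfl }
  refine Module.Finite.of_injective R fun c c' hc => ?_
  refine Subtype.ext (ContinuousAlternatingMap.ext fun v => ?_)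
  have h1 : ∀ c : killedForms K n d N k, c.1 v
      = c.1 fun j => (ofPolyVanishing K n d ∘ₗ truncVanishing K n d N) (v j) := fun c =>
    alternatingMap_congr (c := c.1.toAlternatingMap) c.2 fun j => sub_mem_subVanishing N (v j)
  rw [h1 c, h1 c']
  exact congrArg (fun F => F fun j => (⟨_, v j, rfl⟩ : lowPart K n d N)) hc

/-- Every continuous cocycle is cohomologous to one killed by a fixed `L_N(n)`. -/
theorem exists_sub_mem_killedForms (K : Type*) [Field K] [TopologicalSpace K] [IsTopologicalRing K]
    [CharZero K] [T2Space K] (n d k : ℕ) :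
    ∃ N, ∀ c ∈ cocycles K (vanishing K n d) k,
      ∃ b ∈ coboundaries K (vanishing K n d) k, c - b ∈ killedForms K n d N k := by
  obtain ⟨N, hN⟩ := PolyField.exists_finExact_killedOn (K := K) n d k
  refine ⟨N, fun c hc => ?_⟩
  have hclosed : ceAlg K (vanishing K n d) k c.toAlternatingMap = 0 := by
    ext v
    exact congrArg (fun F => F v) hc
  obtain ⟨N₁, hN₁⟩ := exists_killed c.toAlternatingMap c.cont
  -- The form has to be defined on all polynomial fields, but only its values in order at least `d`
  -- matter, so any linear projection will do.
  obtain ⟨P, hP'⟩ : ∃ P : PolyField K n →ₗ[K] PolyField.vanishing K n d,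
      ∀ u (hu : u ∈ PolyField.vanishing K n d), P u = ⟨u, hu⟩ := by
    obtain ⟨Q, hQ⟩ := (PolyField.vanishing K n d).exists_isCompl
    exact ⟨Submodule.projectionOnto _ _ hQ, fun u hu =>
      Submodule.projectionOnto_apply_left hQ ⟨u, hu⟩⟩
  set f : PolyField K n [⋀^Fin k]→ₗ[K] K :=
    c.toAlternatingMap.compLinearMap (ofPolyVanishing K n d ∘ₗ P) with hf
  have hfc : ∀ u : Fin k → PolyField.vanishing K n d,
      f (fun j => u j) = c fun j => ofPolyVanishing K n d (u j) := by
    intro u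
    rw [hf, AlternatingMap.compLinearMap_apply]
    refine congrArg c (funext fun j => ?_)
    simp only [LinearMap.comp_apply, hP' _ (u j).2]
  -- From order `d` on the projection is the identity; from order `N₁` on the cocycle vanishes.
  obtain ⟨e, he, hfe⟩ := hN f ⟨max d N₁, fun u i hu => by
    rw [hf, AlternatingMap.compLinearMap_apply]
    refine hN₁ _ i ?_
    simp only [LinearMap.comp_apply, hP' _ (PolyField.vanishing_anti (le_max_left d N₁) hu)]
    exact ofPoly_mem_vanishing (PolyField.vanishing_anti (le_max_right d N₁) hu)⟩ fun u hu => by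
      have h1 := ceAlg_ofPolyVanishing (c := c.toAlternatingMap) hfc fun j => ⟨u j, hu j⟩
      rw [hclosed] at h1
      exact h1
  obtain ⟨b, hb, hbe⟩ : ∃ b ∈ coboundaries K (vanishing K n d) k,
      ∀ u : Fin k → PolyField.vanishing K n d,
        e (fun j => u j) = b fun j => ofPolyVanishing K n d (u j) := by
    cases k with
    | zero => exact ⟨0, zero_mem _, fun u => by rw [show e = 0 from he]; rfl⟩
    | succ k =>
      obtain ⟨a, ⟨M, ha⟩, rfl⟩ := he
      -- Since `a` is killed by order `M`, composing with truncation extends it to formal fields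
      -- without changing it on polynomial ones.
      let a' : vanishing K n d [⋀^Fin k]→ₗ[K] K :=
        a.compLinearMap ((PolyField.vanishing K n d).subtype ∘ₗ truncVanishing K n d M)
      have ha' : Continuous a' := continuous_of_killed (N := M) fun v i hv =>
        ha _ i (trunc_mem_vanishing M hv)
      let A : vanishing K n d [⋀^Fin k]→L[K] K := { a' with cont := ha' }
      refine ⟨ceDiff K (vanishing K n d) k A, ⟨A, rfl⟩, fun u => ?_⟩
      refine ceAlg_ofPolyVanishing (c := a') (fun u => ?_) u
      exact alternatingMap_congr ha fun j => sub_trunc_ofPoly_mem M _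
  refine ⟨b, hb, fun v i hv => ?_⟩
  -- The vanishing is known on polynomial fields only. Truncating at an order `N₂` that `c - b` does
  -- not see carries it over to formal fields, while the bound `N` stays uniform.
  obtain ⟨N₂, hN₂⟩ := exists_killed (c - b).toAlternatingMap (c - b).cont
  have h1 := alternatingMap_congr hN₂ (u := v)
    (v := fun j => (ofPolyVanishing K n d ∘ₗ truncVanishing K n d N₂) (v j))
    fun j => sub_mem_subVanishing N₂ (v j)
  refine h1.trans ?_
  have h2 := hfe (fun j => truncVanishing K n d N₂ (v j)) i
    (fun j => (truncVanishing K n d N₂ (v j)).2) (trunc_mem_vanishing N₂ hv)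
  rw [AlternatingMap.sub_apply, hfc fun j => truncVanishing K n d N₂ (v j),
    hbe fun j => truncVanishing K n d N₂ (v j)] at h2
  exact h2

end Cohomology

end FormalVectorField

/-- Every class has a representative in the finite-dimensional space `F ⊓ Z`. -/
theorem LieCohomology.finite_subquotient {K V : Type*} [Field K] [AddCommGroup V] [Module K V]
    {Z B F : Submodule K V} (hBZ : B ≤ Z) (hF : Module.Finite K F)
    (h : ∀ c ∈ Z, ∃ b ∈ B, c - b ∈ F) : Module.Finite K (Subquotient Z B) := by
  have : Module.Finite K (F ⊓ Z : Submodule K V) := Submodule.finiteDimensional_inf_left _ _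
  refine Module.Finite.of_surjective ((B.submoduleOf Z).mkQ ∘ₗ
    Submodule.inclusion (inf_le_right : F ⊓ Z ≤ Z)) fun x => ?_
  obtain ⟨⟨c, hc⟩, rfl⟩ := Submodule.mkQ_surjective _ x
  obtain ⟨b, hb, hcb⟩ := h c hc
  refine ⟨⟨c - b, hcb, Z.sub_mem hc (hBZ hb)⟩, ?_⟩
  rw [LinearMap.comp_apply, ← sub_eq_zero, ← map_sub, Submodule.mkQ_apply,
    Submodule.Quotient.mk_eq_zero]
  change c - b - c ∈ B
  rw [sub_sub_cancel_left]
  exact B.neg_mem hb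

theorem mainTheorem3 (𝕜 : Type*) [Field 𝕜] [CharZero 𝕜]
    [TopologicalSpace 𝕜] [IsTopologicalRing 𝕜] [T2Space 𝕜] (k n d : ℕ) :
    FiniteDimensional 𝕜
      (LieCohomology.ContinuousCohomology 𝕜 (FormalVectorField.vanishing 𝕜 n d) k) := by
  obtain ⟨N, hN⟩ := FormalVectorField.exists_sub_mem_killedForms 𝕜 n d k
  exact LieCohomology.finite_subquotient (LieCohomology.coboundaries_le_cocycles 𝕜 _ k)
    (FormalVectorField.finite_killedForms N k) hN
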